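/- Let $0<q<1$ and let $\mathcal H=\mathcal A(SU_q(2))$ be the unital $*$-algebra generated by $a,c$ with the relations making $u=\begin{pmatrix}a&-qc^*\\c&a^*\end{pmatrix}$ unitary, with coproduct $\Delta u=u\otimes u$. Let $K^{\pm1},E,F$ be the functionals on $\mathcal H$ determined by $K^{\pm1}(a)=q^{\mp1/2}$, $K^{\pm1}(a^*)=q^{\pm1/2}$, $E(c)=1$, $F(c^*)=-q^{-1}$ (zero on the other generators), $\Delta K^{\pm1}=K^{\pm1}\otimes K^{\pm1}$, $\Delta E=E\otimes K+K^{-1}\otimes E$, $\Delta F=F\otimes K+K^{-1}\otimes F$, and let $h\triangleright x=x_{(1)}h(x_{(2)})$. Put $$X_z=\tfrac i2\,\tfrac{K^{-2}-1}{1-q},\qquad X_-=-\tfrac i{\sqrt2}q^{-1/2}EK^{-1},\qquad X_+=-\tfrac i{\sqrt2}q^{1/2}FK^{-1}.$$ Let $\Gamma$ be the free left $\mathcal H$-module on $\omega_-,\omega_z,\omega_+$, and let $\sigma$ be the left $\mathcal H$-linear braiding of $\Gamma\otimes_{\mathcal H}\Gamma$ with $$\sigma(\omega_\pm\otimes\omega_\pm)=\omega_\pm\otimes\omega_\pm,\qquad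 \sigma(\omega_z\otimes\omega_z)=\omega_z\otimes\omega_z+\tfrac{2q(q-1)}{1+q^{-1}}(\omega_+\otimes\omega_--\omega_-\otimes\omega_+),$$ $$\sigma(\omega_a\otimes\omega_b)=q^2\omega_b\otimes\omega_a+(1-q^2)\omega_a\otimes\omega_b,\qquad \sigma(\omega_b\otimes\omega_a)=\omega_a\otimes\omega_b\qquad\text{for }(a,b)=(+,-),(z,-),(+,z).$$ The exterior algebra is $\Gamma_\sigma=\bigoplus_{k=0}^3\Gamma^k_\sigma$, where $\Gamma_\sigma^k$ is the range of the antisymmetriser $A^{(k)}$ on $\Gamma^{\otimes k}$, with $A^{(0)}=A^{(1)}=1$, $A^{(2)}=1-\sigma$, $A^{(3)}=(1-\sigma_2)(1-\sigma_1+\sigma_1\sigma_2)$, and $\omega_{a_1}\wedge\cdots\wedge\omega_{a_k}=A^{(k)}(\omega_{a_1}\otimes\cdots\otimes\omega_{a_k})$; $A^{(k)}$ acts on $\Gamma^k_\sigma$ as $\lambda_{(k)}$, with $\lambda_{(0)}=\lambda_{(1)}=1$, $\lambda_{(2)}=1+q^2$, $\lambda_{(3)}=(1+q^2)(1+q^2+q^4)$.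 The differential $\mathrm d$ on $\Gamma_\sigma$ is given by $\mathrm df=\sum_a(X_a\triangleright f)\,\omega_a$, the graded Leibniz rule and $\mathrm d\omega_a=-\frac1{\lambda_{(2)}}\sum_{b,c}f^a_{bc}\,\omega_b\wedge\omega_c$, where $[X_b,X_c]=\sum_af^a_{bc}X_a$ are the antisymmetric brackets with $$[X_-,X_+]=i\tfrac{2q^2}{1+q}X_z,\qquad [X_z,X_-]=i\tfrac{1+q}2X_-,\qquad [X_+,X_z]=i\tfrac{1+q}2X_+ .$$ For real $\alpha,\beta,\gamma$ with $\alpha\beta\gamma\ne0$ let $\mathrm g(\omega_-,\omega_+)=\alpha$, $\mathrm g(\omega_+,\omega_-)=\beta$, $\mathrm g(\omega_z,\omega_z)=\gamma$ (all other values zero), extended to tensors by contracting the factors of the first argument successively with the first factors of the second. Let $\tau=\delta\,A^{(3)}(i\,\omega_-\otimes\omega_+\otimes\omega_z)$ with real $\delta\neq0$, and let $\star:\Gamma^k_\sigma\to\Gamma^{3-k}_\sigma$ be the left $\mathcal H$-linear map with $\star\omega=\frac1{\lambda_{(k)}}\mathrm g(\omega,\tau)$ on left invariant forms. The parameters $(\alpha,\beta,\gamma,\delta,\xi)$,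 with $\xi<0$ real, are called Cartan–Killing if $\star\omega_a=\xi\,\mathrm d\omega_a$ for $a=-,z,+$ and $\star\tau=1$. Put $A=\frac2{\lambda_{(2)}}\cdot\frac{\lambda_{(3)}}6$. 1. The parameters are Cartan–Killing if and only if $\alpha>0$, $\beta=\alpha$, $\gamma=\big(\frac{2q}{1+q}\big)^2\alpha$, $\delta=\frac{1+q}{2q^3}\big(\frac{\lambda_{(3)}}6\big)^{1/2}\alpha^{-3/2}$ and $\xi=-q^{-1}\big(\frac{\lambda_{(3)}}6\big)^{1/2}\alpha^{-1/2}$. 2. Let the parameters be Cartan–Killing. Then $\star^2=A$ on 1-forms and 2-forms. Let $\varepsilon(1)=\varepsilon(3)=-\varepsilon(2)=1$, let $\kappa=-iA^{-1}$, and let $\mathcal D_{(q)}\omega=\mathrm d\omega+\varepsilon(k)\star\mathrm d(\star\omega)$ for $\omega\in\Gamma^k_\sigma$ (for $k=0$ the second term vanishes). The forms $\psi_0=1+\kappa\tau$ and $\phi_a=\omega_a+\varepsilon(3)\kappa\star\omega_a$ ($a=-,z,+$) are linearly independent over $\mathcal H$, $\mathcal D_{(q)}$ maps the free left $\mathcal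 H$-module $I$ spanned by them to itself, and for all $f_0,f_-,f_z,f_+\in\mathcal H$ the coefficients of $\mathcal D_{(q)}(f_0\psi_0+f_-\phi_-+f_z\phi_z+f_+\phi_+)$ along $\{\psi_0,\phi_-,\phi_z,\phi_+\}$ are $$\begin{pmatrix}0&q^4\alpha X_+&q^2\gamma X_z&\beta X_-\\ X_-&\frac A\xi\big(i-\frac{2q^2}{1+q}X_z\big)&\frac A\xi\frac2{1+q}X_-&0\\ X_z&\frac A\xi\frac{1+q}2X_+&\frac A\xi\big(i+(1-q)X_z\big)&-\frac A\xi\frac{1+q}{2q^2}X_-\\ X_+&0&-\frac A\xi\frac{2q^2}{1+q}X_+&\frac A\xi\big(i+\frac2{1+q}X_z\big)\end{pmatrix}\triangleright\begin{pmatrix}f_0\\f_-\\f_z\\f_+\end{pmatrix}.$$ 3. For each $0<q<1$ choose Cartan–Killing parameters so that $\alpha=\alpha(q)\to1$ as $q\to1^-$. Then $A\to1$, $\xi\to-1$, and the matrix above converges entrywise to the classical Hodge–de Rham matrix $$\begin{pmatrix}0&L_+&L_z&L_-\\L_-&L_z-i&-L_-&0\\L_z&-L_+&-i&L_-\\L_+&0&L_+&-i-L_z\end{pmatrix},$$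 acting on polynomial functions of the coordinates $u,v$ and their conjugates on $SU(2)=\left\{\begin{pmatrix}u&-\bar v\\v&\bar u\end{pmatrix}\right\}$, where $L_\pm=\frac1{\sqrt2}(L_x\pm iL_y)$ and $$L_x=\tfrac i2(\bar v\partial_u-v\partial_{\bar u}-\bar u\partial_v+u\partial_{\bar v}),\quad L_y=\tfrac12(-\bar v\partial_u-v\partial_{\bar u}+\bar u\partial_v+u\partial_{\bar v}),\quad L_z=-\tfrac i2(u\partial_u-\bar u\partial_{\bar u}+v\partial_v-\bar v\partial_{\bar v}).$$ Convergence of operators means: applied to a fixed element of the monomial basis $\{a^nc^jc^{*k},\,a^{*n}c^jc^{*k}\}$ of $\mathcal H$, an entry of the quantum matrix has coefficients in that basis which are supported in a finite set independent of $q$ and converge, as $q\to1^-$, to the coefficients, in the basis $\{u^nv^j\bar v^k,\,\bar u^nv^j\bar v^k\}$, of the corresponding classical entry applied to the corresponding monomial. -/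

import Mathlib

open scoped TensorProduct
open Filter Topology

noncomputable section

namespace SUq2

/-! ### The coordinate algebra of quantum `SU(2)` -/

/-- The generators `a`, `c` and their adjoints `a*`, `c*`. -/
inductive Gen
  | a
  | c
  | aStar
  | cStar

/-- The generators as elements of the free algebra. -/
abbrev gen (x : Gen) : FreeAlgebra ℂ Gen := FreeAlgebra.ι ℂ x

/-- The fundamental matrix `u = (a, -q c*; c, a*)`, in any algebra containing symbols for the
four generators. -/
def fundamental {B : Type} [Ring B] [Algebra ℂ B] (q : ℝ) (x : Gen → B) :
    Matrix (Fin 2) (Fin 2) B :=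
  !![x .a, -((q : ℂ) • x .cStar); x .c, x .aStar]

/-- Its adjoint `u* = (a*, c*; -q c, a)`. -/
def fundamentalAdj {B : Type} [Ring B] [Algebra ℂ B] (q : ℝ) (x : Gen → B) :
    Matrix (Fin 2) (Fin 2) B :=
  !![x .aStar, x .cStar; -((q : ℂ) • x .c), x .a]

/-- The defining relations: the entries of `u u* = 1 = u* u`. This set of relations is stable
under the conjugate-linear anti-automorphism exchanging `a` with `a*` and `c` with `c*`, so the
algebra they present is the `*`-algebra generated by `a` and `c` with these relations. -/
inductive Rel (q : ℝ) : FreeAlgebra ℂ Gen → FreeAlgebra ℂ Gen → Prop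
  | mulAdj (i j : Fin 2) :
      Rel q ((fundamental q gen * fundamentalAdj q gen) i j)
        ((1 : Matrix (Fin 2) (Fin 2) (FreeAlgebra ℂ Gen)) i j)
  | adjMul (i j : Fin 2) :
      Rel q ((fundamentalAdj q gen * fundamental q gen) i j)
        ((1 : Matrix (Fin 2) (Fin 2) (FreeAlgebra ℂ Gen)) i j)

/-- The coordinate algebra `A(SU_q(2))`. -/
def H (q : ℝ) : Type := RingQuot (Rel q)

instance (q : ℝ) : Ring (H q) := inferInstanceAs (Ring (RingQuot (Rel q)))
instance (q : ℝ) : Algebra ℂ (H q) := inferInstanceAs (Algebra ℂ (RingQuot (Rel q)))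

/-- The generators of `A(SU_q(2))`. -/
def H.of (q : ℝ) (x : Gen) : H q := RingQuot.mkAlgHom ℂ (Rel q) (gen x)

/-- An assignment of the generators for which `u` is unitary. -/
def Unitary {B : Type} [Ring B] [Algebra ℂ B] (q : ℝ) (x : Gen → B) : Prop :=
  fundamental q x * fundamentalAdj q x = 1 ∧ fundamentalAdj q x * fundamental q x = 1

theorem lift_rel {B : Type} [Ring B] [Algebra ℂ B] (q : ℝ) (x : Gen → B) (hx : Unitary q x)
    ⦃p r : FreeAlgebra ℂ Gen⦄ (h : Rel q p r) :
    FreeAlgebra.lift ℂ x p = FreeAlgebra.lift ℂ x r := by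
  obtain ⟨h1, h2⟩ := hx
  cases h with
  | mulAdj i j =>
    have h3 := congrFun (congrFun h1 i) j
    revert h3
    fin_cases i <;> fin_cases j <;>
      simp [-Complex.coe_smul, fundamental, fundamentalAdj, Matrix.mul_apply, Fin.sum_univ_two, gen]
  | adjMul i j =>
    have h3 := congrFun (congrFun h2 i) j
    revert h3
    fin_cases i <;> fin_cases j <;>
      simp [-Complex.coe_smul, fundamental, fundamentalAdj, Matrix.mul_apply, Fin.sum_univ_two, gen]

/-- The universal property of `A(SU_q(2))`. -/
def H.lift {B : Type} [Ring B] [Algebra ℂ B] (q : ℝ) (x : Gen → B) (hx : Unitary q x) :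
    H q →ₐ[ℂ] B :=
  RingQuot.liftAlgHom ℂ ⟨FreeAlgebra.lift ℂ x, lift_rel q x hx⟩

theorem H.lift_of {B : Type} [Ring B] [Algebra ℂ B] (q : ℝ) (x : Gen → B) (hx : Unitary q x)
    (g : Gen) : H.lift q x hx (H.of q g) = x g := by
  unfold H.lift H.of
  erw [RingQuot.liftAlgHom_mkAlgHom_apply]
  simp [gen]

theorem H.unitary_of (q : ℝ) : Unitary q (H.of q) := by
  have key : ∀ {p r}, Rel q p r →
      (RingQuot.mkAlgHom ℂ (Rel q) p : RingQuot (Rel q)) = RingQuot.mkAlgHom ℂ (Rel q) r :=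
    fun h => RingQuot.mkAlgHom_rel ℂ h
  constructor
  · ext i j
    have h3 := key (Rel.mulAdj i j)
    revert h3
    fin_cases i <;> fin_cases j <;>
      simp [-Complex.coe_smul, fundamental, fundamentalAdj, Matrix.mul_apply, Fin.sum_univ_two] <;>
      intro h3 <;> exact h3
  · ext i j
    have h3 := key (Rel.adjMul i j)
    revert h3
    fin_cases i <;> fin_cases j <;>
      simp [-Complex.coe_smul, fundamental, fundamentalAdj, Matrix.mul_apply, Fin.sum_univ_two] <;>
      intro h3 <;> exact h3

theorem Unitary.map {B C : Type} [Ring B] [Algebra ℂ B] [Ring C] [Algebra ℂ C] {q : ℝ}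
    {x : Gen → B} (hx : Unitary q x) (φ : B →ₐ[ℂ] C) : Unitary q (fun g => φ (x g)) := by
  have e1 : fundamental q (fun g => φ (x g)) = φ.mapMatrix (fundamental q x) := by
    ext i j
    fin_cases i <;> fin_cases j <;> simp [-Complex.coe_smul, fundamental]
  have e2 : fundamentalAdj q (fun g => φ (x g)) = φ.mapMatrix (fundamentalAdj q x) := by
    ext i j
    fin_cases i <;> fin_cases j <;> simp [-Complex.coe_smul, fundamentalAdj]
  refine ⟨?_, ?_⟩
  · rw [e1, e2, ← map_mul, hx.1, map_one]
  · rw [e1, e2, ← map_mul, hx.2, map_one]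

/-- The coproduct on generators, i.e. the entries of `Δ u = u ⊗ u`. -/
def comulGen (q : ℝ) : Gen → H q ⊗[ℂ] H q
  | .a => H.of q .a ⊗ₜ H.of q .a - (q : ℂ) • (H.of q .cStar ⊗ₜ H.of q .c)
  | .c => H.of q .c ⊗ₜ H.of q .a + H.of q .aStar ⊗ₜ H.of q .c
  | .aStar => H.of q .aStar ⊗ₜ H.of q .aStar - (q : ℂ) • (H.of q .c ⊗ₜ H.of q .cStar)
  | .cStar => H.of q .cStar ⊗ₜ H.of q .aStar + H.of q .a ⊗ₜ H.of q .cStar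

theorem comulGen_unitary (q : ℝ) : Unitary q (comulGen q) := by
  set l : H q →ₐ[ℂ] H q ⊗[ℂ] H q := Algebra.TensorProduct.includeLeft
  set r : H q →ₐ[ℂ] H q ⊗[ℂ] H q := Algebra.TensorProduct.includeRight
  have hl := (H.unitary_of q).map l
  have hr := (H.unitary_of q).map r
  have e1 : fundamental q (comulGen q) =
      fundamental q (fun g => l (H.of q g)) * fundamental q (fun g => r (H.of q g)) := by
    ext i j
    fin_cases i <;> fin_cases j <;>
      simp [-Complex.coe_smul, fundamental, comulGen, Matrix.mul_apply, Fin.sum_univ_two, l, r,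
        sub_eq_add_neg, TensorProduct.smul_tmul', add_comm]
  have e2 : fundamentalAdj q (comulGen q) =
      fundamentalAdj q (fun g => r (H.of q g)) * fundamentalAdj q (fun g => l (H.of q g)) := by
    ext i j
    fin_cases i <;> fin_cases j <;>
      simp [-Complex.coe_smul, fundamentalAdj, comulGen, Matrix.mul_apply, Fin.sum_univ_two, l, r,
        sub_eq_add_neg, TensorProduct.smul_tmul', add_comm]
  refine ⟨?_, ?_⟩
  · rw [e1, e2, Matrix.mul_assoc, ← Matrix.mul_assoc _ _ (fundamentalAdj q _), hr.1,
      Matrix.one_mul, hl.1]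
  · rw [e1, e2, Matrix.mul_assoc, ← Matrix.mul_assoc _ _ (fundamental q _), hl.2,
      Matrix.one_mul, hr.2]

/-- The coproduct `Δ`. -/
def comul (q : ℝ) : H q →ₐ[ℂ] H q ⊗[ℂ] H q := H.lift q (comulGen q) (comulGen_unitary q)

/-! ### The quantum enveloping algebra inside the dual algebra, and its left action -/

/-- Linear functionals on `A(SU_q(2))`. -/
abbrev Dual (q : ℝ) : Type := H q →ₗ[ℂ] ℂ

/-- The product of the dual algebra, `(f g)(x) = f(x₁) g(x₂)`. -/
def conv {q : ℝ} (f g : Dual q) : Dual q :=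
  LinearMap.mul' ℂ ℂ ∘ₗ TensorProduct.map f g ∘ₗ (comul q).toLinearMap

/-- The left action `h ▷ x = x₁ h(x₂)`. -/
def act {q : ℝ} (h : Dual q) : Module.End ℂ (H q) :=
  (TensorProduct.rid ℂ (H q)).toLinearMap ∘ₗ LinearMap.lTensor (H q) h ∘ₗ (comul q).toLinearMap

/-- The unit `ε` of the dual algebra: the counit `ε(u) = 1`. -/
def epsGen : Gen → ℂ
  | .a => 1
  | .aStar => 1
  | .c => 0
  | .cStar => 0

theorem epsGen_unitary (q : ℝ) : Unitary q epsGen := by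
  constructor <;> ext i j <;> fin_cases i <;> fin_cases j <;>
    simp [fundamental, fundamentalAdj, Matrix.mul_apply, Fin.sum_univ_two, epsGen]

def eps (q : ℝ) : Dual q := (H.lift q epsGen (epsGen_unitary q)).toLinearMap

/-- For `0 < q` the assignments below present the functionals `K⁻¹`, `K`, `E`, `F`
through upper triangular representations of `A(SU_q(2))`. As `K^{±1}` is group-like it is a
character, and `Δ E = E ⊗ K + K⁻¹ ⊗ E` (similarly for `F`) says that
`x ↦ (K⁻¹(x), E(x); 0, K(x))` is multiplicative. The pairing on generators is
`K^{±1}(a) = q^{∓1/2}`, `K^{±1}(a*) = q^{±1/2}`, `E(c) = 1`, `F(c*) = -q⁻¹`, all other values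
being zero. The argument `e` is the pair `(E(c), E(c*))`, respectively `(F(c), F(c*))`. -/
def triGen (q : ℝ) (e : ℂ × ℂ) : Gen → Matrix (Fin 2) (Fin 2) ℂ
  | .a => !![(Real.sqrt q : ℂ), 0; 0, ((Real.sqrt q : ℂ))⁻¹]
  | .aStar => !![((Real.sqrt q : ℂ))⁻¹, 0; 0, (Real.sqrt q : ℂ)]
  | .c => !![0, e.1; 0, 0]
  | .cStar => !![0, e.2; 0, 0]

theorem triGen_unitary {q : ℝ} (hq : 0 < q) (e : ℂ × ℂ) : Unitary q (triGen q e) := by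
  have h0 : (Real.sqrt q : ℂ) ≠ 0 := by
    exact_mod_cast (Real.sqrt_pos.2 hq).ne'
  have h1 : (q : ℂ) = (Real.sqrt q : ℂ) * (Real.sqrt q : ℂ) := by
    exact_mod_cast (Real.mul_self_sqrt hq.le).symm
  constructor <;> ext i j k l <;> fin_cases i <;> fin_cases j <;>
    fin_cases k <;> fin_cases l <;>
    simp [-Complex.coe_smul, fundamental, fundamentalAdj, Matrix.mul_apply, Fin.sum_univ_two,
      triGen, h0] <;>
    (try rw [h1]) <;> (try field_simp) <;> (try ring)

open Classical in
/-- The `(i, j)` coefficient of the triangular representation (only used for `0 < q`). -/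
def triCoeff (q : ℝ) (e : ℂ × ℂ) (i j : Fin 2) : Dual q :=
  if hq : 0 < q then
    Matrix.entryLinearMap ℂ ℂ i j ∘ₗ (H.lift q (triGen q e) (triGen_unitary hq e)).toLinearMap
  else 0

/-- The functional `K⁻¹`. -/
def Kinv (q : ℝ) : Dual q := triCoeff q (0, 0) 0 0

/-- The functional `K`. -/
def K (q : ℝ) : Dual q := triCoeff q (0, 0) 1 1

/-- The functional `E`. -/
def E (q : ℝ) : Dual q := triCoeff q (1, 0) 0 1

/-- The functional `F`. -/
def F (q : ℝ) : Dual q := triCoeff q (0, -((q : ℂ))⁻¹) 0 1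

/-- The three labels `-`, `z`, `+`. -/
inductive Idx
  | minus
  | z
  | plus
  deriving DecidableEq

instance : Fintype Idx := ⟨{.minus, .z, .plus}, by rintro (_ | _ | _) <;> simp⟩

/-- The basis `X_-`, `X_z`, `X_+` of the quantum tangent space. -/
def tangent (q : ℝ) : Idx → Dual q
  | .minus => (-(Complex.I / (Real.sqrt 2 : ℂ)) * ((Real.sqrt q : ℂ))⁻¹) • conv (E q) (Kinv q)
  | .z => (Complex.I / 2 * (1 - (q : ℂ))⁻¹) • (conv (Kinv q) (Kinv q) - eps q)
  | .plus => (-(Complex.I / (Real.sqrt 2 : ℂ)) * (Real.sqrt q : ℂ)) • conv (F q) (Kinv q)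

/-- The left actions `f ↦ X_a ▷ f`. -/
def X (q : ℝ) (a : Idx) : Module.End ℂ (H q) := act (tangent q a)

/-! ### The exterior algebra

The bimodule of one-forms is free as a left module over `H = A(SU_q(2))` on `ω_-`, `ω_z`, `ω_+`,
so its `k`-th tensor power over `H` is the free left module on `ω_{a₁} ⊗ ⋯ ⊗ ω_{aₖ}`; a tensor is
given by its family of left coefficients. -/

abbrev T1 (q : ℝ) : Type := Idx → H q
abbrev T2 (q : ℝ) : Type := Idx → Idx → H q
abbrev T3 (q : ℝ) : Type := Idx → Idx → Idx → H q

/-- Coefficients of `ω_a ⊗ ω_b`. -/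
def e2 (a b k s : Idx) : ℂ := if a = k ∧ b = s then 1 else 0

/-- The braiding on left invariant forms:
`σ(ω_a ⊗ ω_b) = ∑ braid q a b k s • ω_k ⊗ ω_s`. -/
def braid (q : ℝ) (a b k s : Idx) : ℂ :=
  match a, b with
  | .minus, .minus => e2 .minus .minus k s
  | .plus, .plus => e2 .plus .plus k s
  | .z, .z => e2 .z .z k s +
      (2 * (q : ℂ) * ((q : ℂ) - 1) / (1 + (q : ℂ)⁻¹)) * (e2 .plus .minus k s - e2 .minus .plus k s)
  | .plus, .minus => (q : ℂ) ^ 2 * e2 .minus .plus k s + (1 - (q : ℂ) ^ 2) * e2 .plus .minus k s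
  | .minus, .plus => e2 .plus .minus k s
  | .z, .minus => (q : ℂ) ^ 2 * e2 .minus .z k s + (1 - (q : ℂ) ^ 2) * e2 .z .minus k s
  | .minus, .z => e2 .z .minus k s
  | .plus, .z => (q : ℂ) ^ 2 * e2 .z .plus k s + (1 - (q : ℂ) ^ 2) * e2 .plus .z k s
  | .z, .plus => e2 .plus .z k s

/-- The braiding `σ` on `Γ ⊗ Γ`. -/
def sigma (q : ℝ) : Module.End (H q) (T2 q) where
  toFun t := fun k s => ∑ a, ∑ b, braid q a b k s • t a b
  map_add' t t' := by
    ext k s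
    simp [Finset.sum_add_distrib]
  map_smul' h t := by
    ext k s
    simp [Finset.mul_sum]

/-- `σ₁ = σ ⊗ 1` on `Γ ⊗ Γ ⊗ Γ`. -/
def sigma1 (q : ℝ) : Module.End (H q) (T3 q) where
  toFun t := fun k s r => ∑ a, ∑ b, braid q a b k s • t a b r
  map_add' t t' := by
    ext k s r
    simp [Finset.sum_add_distrib]
  map_smul' h t := by
    ext k s r
    simp [Finset.mul_sum]

/-- `σ₂ = 1 ⊗ σ` on `Γ ⊗ Γ ⊗ Γ`. -/
def sigma2 (q : ℝ) : Module.End (H q) (T3 q) where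
  toFun t := fun r k s => ∑ a, ∑ b, braid q a b k s • t r a b
  map_add' t t' := by
    ext r k s
    simp [Finset.sum_add_distrib]
  map_smul' h t := by
    ext r k s
    simp [Finset.mul_sum]

/-- The antisymmetriser `A⁽²⁾ = 1 - σ`. -/
def A2 (q : ℝ) : Module.End (H q) (T2 q) := 1 - sigma q

/-- The antisymmetriser `A⁽³⁾ = (1 - σ₂)(1 - σ₁ + σ₁ σ₂)`. -/
def A3 (q : ℝ) : Module.End (H q) (T3 q) := (1 - sigma2 q) * (1 - sigma1 q + sigma1 q * sigma2 q)

/-- The eigenvalue of `A⁽²⁾` on two-forms. -/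
def lam2 (q : ℝ) : ℝ := 1 + q ^ 2

/-- The eigenvalue of `A⁽³⁾` on three-forms. -/
def lam3 (q : ℝ) : ℝ := (1 + q ^ 2) * (1 + q ^ 2 + q ^ 4)

/-- Two-forms: the range of `A⁽²⁾`, where
`(f ω_a) ∧ ω_b = A⁽²⁾(f ω_a ⊗ ω_b)`. -/
abbrev G2 (q : ℝ) : Submodule (H q) (T2 q) := LinearMap.range (A2 q)

/-- Three-forms: the range of `A⁽³⁾`, where
`(f ω_a) ∧ ω_b ∧ ω_c = A⁽³⁾(f ω_a ⊗ ω_b ⊗ ω_c)`. -/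
abbrev G3 (q : ℝ) : Submodule (H q) (T3 q) := LinearMap.range (A3 q)

/-- The exterior algebra `Γ_σ = Γ⁰ ⊕ Γ¹ ⊕ Γ² ⊕ Γ³`, as a left module over `A(SU_q(2))`. -/
abbrev Form (q : ℝ) : Type := H q × T1 q × G2 q × G3 q

/-- The left invariant one-form `ω_a`, as a tensor. -/
def om (q : ℝ) (a : Idx) : T1 q := fun k => if a = k then 1 else 0

/-- The left invariant one-form `ω_a`, as an element of the exterior algebra. -/
def omega (q : ℝ) (a : Idx) : Form q := (0, om q a, 0, 0)

/-- The structure constants `[X_a, X_b] = ∑ f_{ab}^c X_c` of the quantum tangent space, for the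
commutator `[X_a, X_b] = X_a X_b - ∑ braid q k s a b • X_k X_s` of the dual algebra. -/
def struct (q : ℝ) (a b c : Idx) : ℂ :=
  match a, b, c with
  | .minus, .plus, .z => Complex.I * (2 * (q : ℂ) ^ 2 / (1 + (q : ℂ)))
  | .plus, .minus, .z => -(Complex.I * (2 * (q : ℂ) ^ 2 / (1 + (q : ℂ))))
  | .z, .minus, .minus => Complex.I * ((1 + (q : ℂ)) / 2)
  | .minus, .z, .minus => -(Complex.I * ((1 + (q : ℂ)) / 2))
  | .plus, .z, .plus => Complex.I * ((1 + (q : ℂ)) / 2)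
  | .z, .plus, .plus => -(Complex.I * ((1 + (q : ℂ)) / 2))
  | _, _, _ => 0

/-- The Maurer-Cartan formula `dω_a = -(1/λ₂) ∑ f_{bc}^a ω_b ∧ ω_c`: the coefficients of a tensor
whose image under `A⁽²⁾` is `dω_a`. -/
def mc (q : ℝ) (a b c : Idx) : ℂ := -((lam2 q : ℂ))⁻¹ * struct q b c a

/-! The exterior differential: `df = ∑ (X_a ▷ f) ω_a` on functions, the Maurer-Cartan formula on
the `ω_a`, and the graded Leibniz rule. -/

/-- `df = ∑ (X_a ▷ f) ω_a`. -/
def d0 (q : ℝ) : H q →ₗ[ℂ] T1 q := LinearMap.pi (fun a => X q a)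

/-- `d(f ω_a) = ∑ (X_b ▷ f) ω_b ∧ ω_a + f dω_a`. -/
def d1 (q : ℝ) : T1 q →ₗ[ℂ] G2 q :=
  (A2 q).rangeRestrict.restrictScalars ℂ ∘ₗ
    { toFun := fun t b c => X q b (t c) + ∑ a, mc q a b c • t a
      map_add' := fun t t' => by
        ext b c
        simp [Finset.sum_add_distrib]
        abel
      map_smul' := fun r t => by
        ext b c
        simp [Finset.smul_sum, smul_comm r] }

/-- `d(f ω_a ∧ ω_b) = ∑ (X_c ▷ f) ω_c ∧ ω_a ∧ ω_b + f (dω_a ∧ ω_b - ω_a ∧ dω_b)`. A two-form `t`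
is `(1/λ₂) ∑ t_{ab} ω_a ∧ ω_b`, because `A⁽²⁾` is multiplication by `λ₂` on its range. -/
def d2 (q : ℝ) : G2 q →ₗ[ℂ] G3 q :=
  ((lam2 q : ℂ))⁻¹ • ((A3 q).rangeRestrict.restrictScalars ℂ ∘ₗ
    { toFun := fun t b c e => X q b (t c e) + ∑ a, mc q a b c • t a e - ∑ a, mc q a c e • t b a
      map_add' := fun t t' => by
        ext b c e
        simp [Finset.sum_add_distrib]
        abel
      map_smul' := fun r t => by
        ext b c e
        simp [Finset.smul_sum, smul_comm r, smul_sub] } ∘ₗ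
      ((G2 q).subtype.restrictScalars ℂ))

/-- The exterior differential on `Γ_σ`; it vanishes on three-forms as `Γ⁴ = 0`. -/
def extd (q : ℝ) : Form q →ₗ[ℂ] Form q where
  toFun w := (0, d0 q w.1, d1 q w.2.1, d2 q w.2.2.1)
  map_add' w w' := by simp
  map_smul' r w := by simp

/-! ### The Hodge duality -/

/-- The volume form `θ = A⁽³⁾(i ω_- ⊗ ω_+ ⊗ ω_z)`. -/
def theta (q : ℝ) : G3 q :=
  (A3 q).rangeRestrict
    (fun a b c => if a = .minus ∧ b = .plus ∧ c = .z then algebraMap ℂ (H q) Complex.I else 0)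

/-- The volume form `τ = δ θ`. -/
def tau (q δ : ℝ) : G3 q := (δ : ℂ) • theta q

/-- The bilinear map `g` on left invariant one-forms, with
`g(ω_-, ω_+) = α`, `g(ω_+, ω_-) = β`, `g(ω_z, ω_z) = γ`. -/
def metric (α β γ : ℝ) : Idx → Idx → ℂ
  | .minus, .plus => α
  | .plus, .minus => β
  | .z, .z => γ
  | _, _ => 0

theorem slot_mem {q : ℝ} (u : G3 q) (b : Idx) : (u : T3 q) b ∈ G2 q := by
  obtain ⟨u, t, rfl⟩ := u
  exact ⟨((1 - sigma1 q + sigma1 q * sigma2 q) t) b, rfl⟩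

theorem csmul_mem {q : ℝ} (r : ℂ) {t : T2 q} (ht : t ∈ G2 q) : r • t ∈ G2 q := by
  have h : r • t = algebraMap ℂ (H q) r • t := by
    ext i j
    simp [Algebra.smul_def]
  rw [h]
  exact (G2 q).smul_mem _ ht

/-- The maps `S(ω) = (1/λ_k) g(ω, τ)`, extended by left linearity, on forms of degree `k`; here
`λ₀ = λ₁ = 1`. -/
def S0 (q δ : ℝ) : H q →ₗ[ℂ] G3 q where
  toFun f := f • tau q δ
  map_add' f f' := add_smul _ _ _
  map_smul' r f := by simp

def S1 (q α β γ δ : ℝ) : T1 q →ₗ[ℂ] G2 q where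
  toFun t := ⟨∑ a, ∑ b, metric α β γ a b • (t a • (tau q δ : T3 q) b), Submodule.sum_mem _ fun a _ =>
    Submodule.sum_mem _ fun b _ => csmul_mem _ ((G2 q).smul_mem _ (slot_mem (tau q δ) b))⟩
  map_add' t t' := by
    ext i j
    simp [add_mul, Finset.sum_add_distrib]
  map_smul' r t := by
    ext i j
    simp [Finset.smul_sum, smul_comm r]

def S2 (q α β γ δ : ℝ) : G2 q →ₗ[ℂ] T1 q where
  toFun t := fun k => ((lam2 q : ℂ))⁻¹ • ∑ a, ∑ a', ∑ b, ∑ b',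
    (metric α β γ a b * metric α β γ a' b') • ((t : T2 q) a a' * (tau q δ : T3 q) b b' k)
  map_add' t t' := by
    ext k
    simp [add_mul, Finset.sum_add_distrib]
  map_smul' r t := by
    ext k
    simp [Finset.smul_sum, smul_comm r]

def S3 (q α β γ δ : ℝ) : G3 q →ₗ[ℂ] H q where
  toFun t := ((lam3 q : ℂ))⁻¹ • ∑ a, ∑ a', ∑ a'', ∑ b, ∑ b', ∑ b'',
    (metric α β γ a b * metric α β γ a' b' * metric α β γ a'' b'') •
      ((t : T3 q) a a' a'' * (tau q δ : T3 q) b b' b'')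
  map_add' t t' := by
    simp [add_mul, Finset.sum_add_distrib]
  map_smul' r t := by
    simp [Finset.smul_sum, smul_comm r]

/-- The Hodge operator `⋆ = S` on `Γ_σ`, mapping `Γᵏ` to `Γ³⁻ᵏ`. -/
def star (q α β γ δ : ℝ) : Form q →ₗ[ℂ] Form q where
  toFun w := (S3 q α β γ δ w.2.2.2, S2 q α β γ δ w.2.2.1, S1 q α β γ δ w.2.1, S0 q δ w.1)
  map_add' w w' := by simp
  map_smul' r w := by simp

/-- The volume form `τ` as an element of `Γ_σ`. -/
def vol (q δ : ℝ) : Form q := (0, 0, 0, tau q δ)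

/-- The function `1` as an element of `Γ_σ`. -/
def unit (q : ℝ) : Form q := (1, 0, 0, 0)

/-- The real parameters `α, β, γ` (non-degeneracy), `δ` (volume form) and `ξ` define a quantum
Cartan-Killing metric: `⋆ω_a = ξ dω_a` for all left invariant one-forms, with the normalisation
`⋆τ = 1` and the orientation for which `ξ` is negative. -/
structure IsCartanKilling (q α β γ δ ξ : ℝ) : Prop where
  nondegenerate : α * β * γ ≠ 0
  volume : δ ≠ 0
  neg : ξ < 0
  killing : ∀ a : Idx, star q α β γ δ (omega q a) = (ξ : ℂ) • extd q (omega q a)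
  normalised : star q α β γ δ (vol q δ) = unit q

/-- The scalar `A = (2/λ₂)(λ₃/6)`. -/
def coefA (q : ℝ) : ℝ := 2 / lam2 q * (lam3 q / 6)

/-! ### The Hodge - de Rham operator -/

/-- Multiplication by `ε(k)` on forms of degree `k`. -/
def scale (q : ℝ) (ε : ℕ → ℂ) : Form q →ₗ[ℂ] Form q where
  toFun w := (ε 0 • w.1, ε 1 • w.2.1, ε 2 • w.2.2.1, ε 3 • w.2.2.2)
  map_add' w w' := by simp
  map_smul' r w := by simp [smul_comm r]

/-- `D(ω) = dω + ε(k) ⋆d(⋆ω)` on forms of degree `k`. The value of `ε(0)` is irrelevant, since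
`d⋆` vanishes on functions. -/
def dirac (q α β γ δ : ℝ) (ε : ℕ → ℂ) : Form q →ₗ[ℂ] Form q :=
  extd q + star q α β γ δ ∘ₗ extd q ∘ₗ star q α β γ δ ∘ₗ scale q ε

/-- `ψ₀ = 1 + κ τ`. -/
def psi0 (q δ : ℝ) (κ : ℂ) : Form q := unit q + κ • vol q δ

/-- `φ_a = ω_a + ε(3) κ ⋆ω_a`. -/
def phi (q α β γ δ : ℝ) (ε : ℕ → ℂ) (κ : ℂ) (a : Idx) : Form q :=
  omega q a + (ε 3 * κ) • star q α β γ δ (omega q a)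

/-- The family `ψ₀, φ_-, φ_z, φ_+`. -/
def spinorBasis (q α β γ δ : ℝ) (ε : ℕ → ℂ) (κ : ℂ) : Fin 4 → Form q :=
  ![psi0 q δ κ, phi q α β γ δ ε κ .minus, phi q α β γ δ ε κ .z, phi q α β γ δ ε κ .plus]

/-- The left module `I` spanned by `ψ₀, φ_-, φ_z, φ_+`. -/
def spinors (q α β γ δ : ℝ) (ε : ℕ → ℂ) (κ : ℂ) : Submodule (H q) (Form q) :=
  Submodule.span (H q) (Set.range (spinorBasis q α β γ δ ε κ))

/-- The matrix of left acting operators representing the quantum Hodge - de Rham operator. -/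
def diracMatrix (q α β γ ξ : ℝ) : Matrix (Fin 4) (Fin 4) (Module.End ℂ (H q)) :=
  let s : ℂ := (coefA q : ℂ) * (ξ : ℂ)⁻¹
  let p : ℂ := (q : ℂ)
  let i : Module.End ℂ (H q) := Complex.I • 1
  !![0, (p ^ 4 * α) • X q .plus, (p ^ 2 * γ) • X q .z, (β : ℂ) • X q .minus;
    X q .minus, s • (i - (2 * p ^ 2 / (1 + p)) • X q .z), (s * (2 / (1 + p))) • X q .minus, 0;
    X q .z, (s * ((1 + p) / 2)) • X q .plus, s • (i + (1 - p) • X q .z),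
      -((s * ((1 + p) / (2 * p ^ 2))) • X q .minus);
    X q .plus, 0, -((s * (2 * p ^ 2 / (1 + p))) • X q .plus),
      s • (i + (2 / (1 + p)) • X q .z)]

/-! ### The classical operator on `SU(2)` -/

/-- Polynomials in the coordinates `u, v, ū, v̄` (labelled `a, c, aStar, cStar`). -/
abbrev Pol : Type := MvPolynomial Gen ℂ

/-- The coordinates on `SU(2)`, a point being the matrix `(u, -v̄; v, ū)`. -/
def coord (g : Gen) (p : Matrix.specialUnitaryGroup (Fin 2) ℂ) : ℂ :=
  match g with
  | .a => (p : Matrix (Fin 2) (Fin 2) ℂ) 0 0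
  | .c => (p : Matrix (Fin 2) (Fin 2) ℂ) 1 0
  | .aStar => (starRingEnd ℂ) ((p : Matrix (Fin 2) (Fin 2) ℂ) 0 0)
  | .cStar => (starRingEnd ℂ) ((p : Matrix (Fin 2) (Fin 2) ℂ) 1 0)

/-- The polynomial function on `SU(2)` defined by a polynomial. -/
def toFunction : Pol →ₐ[ℂ] (Matrix.specialUnitaryGroup (Fin 2) ℂ → ℂ) :=
  MvPolynomial.aeval coord

/-- `L_x = (i/2)(v̄ ∂_u - v ∂_ū - ū ∂_v + u ∂_v̄)`. -/
def Lx : Derivation ℂ Pol Pol := MvPolynomial.mkDerivation ℂ fun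
  | .a => (Complex.I / 2) • MvPolynomial.X Gen.cStar
  | .aStar => -((Complex.I / 2) • MvPolynomial.X Gen.c)
  | .c => -((Complex.I / 2) • MvPolynomial.X Gen.aStar)
  | .cStar => (Complex.I / 2) • MvPolynomial.X Gen.a

/-- `L_y = (1/2)(-v̄ ∂_u - v ∂_ū + ū ∂_v + u ∂_v̄)`. -/
def Ly : Derivation ℂ Pol Pol := MvPolynomial.mkDerivation ℂ fun
  | .a => -((1 / 2 : ℂ) • MvPolynomial.X Gen.cStar)
  | .aStar => -((1 / 2 : ℂ) • MvPolynomial.X Gen.c)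
  | .c => (1 / 2 : ℂ) • MvPolynomial.X Gen.aStar
  | .cStar => (1 / 2 : ℂ) • MvPolynomial.X Gen.a

/-- `L_z = -(i/2)(u ∂_u - ū ∂_ū + v ∂_v - v̄ ∂_v̄)`. -/
def Lz : Derivation ℂ Pol Pol := MvPolynomial.mkDerivation ℂ fun
  | .a => -((Complex.I / 2) • MvPolynomial.X Gen.a)
  | .aStar => (Complex.I / 2) • MvPolynomial.X Gen.aStar
  | .c => -((Complex.I / 2) • MvPolynomial.X Gen.c)
  | .cStar => (Complex.I / 2) • MvPolynomial.X Gen.cStar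

/-- `L_± = (L_x ± i L_y)/√2`, together with `L_z`. -/
def L : Idx → Module.End ℂ Pol
  | .minus => ((Real.sqrt 2 : ℂ))⁻¹ • (Lx.toLinearMap - Complex.I • Ly.toLinearMap)
  | .z => Lz.toLinearMap
  | .plus => ((Real.sqrt 2 : ℂ))⁻¹ • (Lx.toLinearMap + Complex.I • Ly.toLinearMap)

/-- The matrix of the classical Hodge - de Rham operator. -/
def classicalMatrix : Matrix (Fin 4) (Fin 4) (Module.End ℂ Pol) :=
  let i : Module.End ℂ Pol := Complex.I • 1
  !![0, L .plus, L .z, L .minus;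
    L .minus, L .z - i, -L .minus, 0;
    L .z, -L .plus, -i, L .minus;
    L .plus, 0, L .plus, -i - L .z]

/-! ### The classical limit -/

/-- The monomial `a^n c^j c*^k` (for `n ≥ 0`) or `a*^{-n} c^j c*^k` (for `n < 0`) in the values
of the four generators. These monomials form a linear basis of `A(SU_q(2))`, as well as of the
polynomial functions on `SU(2)`. -/
def monomial {B : Type} [Monoid B] (x : Gen → B) (m : ℤ × ℕ × ℕ) : B :=
  (if 0 ≤ m.1 then x .a ^ m.1.toNat else x .aStar ^ (-m.1).toNat) *
    x .c ^ m.2.1 * x .cStar ^ m.2.2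

/-- The operators `P q` on `A(SU_q(2))` converge to the operator `Q` on polynomial functions on
`SU(2)` as `q → 1`: on each basis monomial, the coefficients of the image in the monomial basis
converge to those of the classical image (and are supported in a finite set independent of `q`). -/
def ConvergesToClassical (P : (q : ℝ) → Module.End ℂ (H q)) (Q : Module.End ℂ Pol) : Prop :=
  ∀ m : ℤ × ℕ × ℕ, ∃ (s : Finset (ℤ × ℕ × ℕ)) (w : ℝ → ℤ × ℕ × ℕ → ℂ) (w₁ : ℤ × ℕ × ℕ → ℂ),
    (∀ q ∈ Set.Ioo (0 : ℝ) 1,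
      P q (monomial (H.of q) m) = ∑ n ∈ s, w q n • monomial (H.of q) n) ∧
    (∀ n ∈ s, Tendsto (fun q => w q n) (𝓝[<] 1) (𝓝 (w₁ n))) ∧
    toFunction (Q (monomial MvPolynomial.X m)) =
      ∑ n ∈ s, w₁ n • toFunction (monomial MvPolynomial.X n)

end SUq2
end

noncomputable section

namespace SUq2

/-! ### Coordinates on the exterior algebra -/

/-! Although the braiding depends on `q`, the ranges of the antisymmetrisers consist of ordinary
antisymmetric tensors; `q` enters only through the coordinate maps `coord2` and `coord3` (`A2_eq`,
`A3_eq`). Two-forms and three-forms are therefore free of rank 3 and 1, and in these coordinates ⋆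
is multiplication by scalars and d is built from the `X q a` and constants (`star_form`,
`extd_form`).

Cartan-Killing parameters: each `X q a` kills 1, so ⋆ω_a = ξ dω_a is one scalar equation for each
label (`killing_iff`), and ⋆τ = 1 is a fourth (`normalised_iff`). The first three fix β/α, γ/α and
δα/ξ. The fourth then says that a square times α equals a positive number, which forces α > 0 and
fixes |δ|; the sign of ξ selects δ > 0.

Dirac operator: `IsCartanKilling.scalars` expresses β, γ, δ and λ₃ rationally in q, α, ξ, without
square roots. After this elimination ⋆² = A and the matrix formula are comparisons of rational
coefficients, degree by degree. Degrees 0 and 1 determine the coefficients along the spinor basis;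
the value of κ makes degrees 2 and 3 agree with them.

Classical limit: each `X q a` is a twisted derivation (`X_mul`) whose values on generators have no
pole at q = 1 (`X_of`), because the factor 1/(1-q) cancels there. The reordering relations have
coefficients continuous at q = 1, so families with a limit are closed under products
(`HasLimit.mul`), and the Leibniz rule carries convergence from generators to monomials
(`HasSmoothLimit`). Only the existence of expansions in monomials is needed, not their uniqueness.
-/

theorem sum_idx {M : Type*} [AddCommMonoid M] (f : Idx → M) :
    ∑ a, f a = f .minus + (f .z + f .plus) := by
  change Finset.sum {.minus, .z, .plus} f = _
  rw [Finset.sum_insert (by decide), Finset.sum_pair (by decide)]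

/-- The coefficient of `ω_+ ⊗ ω_- - ω_- ⊗ ω_+` in `σ(ω_z ⊗ ω_z)`. -/
def skew (q : ℝ) : ℂ := 2 * (q : ℂ) * ((q : ℂ) - 1) / (1 + (q : ℂ)⁻¹)

/-- The two-form with coefficients `f` along `ω_- ⊗ ω_z - ω_z ⊗ ω_-`, `ω_- ⊗ ω_+ - ω_+ ⊗ ω_-` and
`ω_z ⊗ ω_+ - ω_+ ⊗ ω_z`. -/
def alt2 {q : ℝ} (f : Idx → H q) : T2 q
  | .minus, .z => f .minus
  | .z, .minus => -f .minus
  | .minus, .plus => f .z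
  | .plus, .minus => -f .z
  | .z, .plus => f .plus
  | .plus, .z => -f .plus
  | _, _ => 0

/-- The totally antisymmetric tensor with coefficient `f` at `ω_- ⊗ ω_+ ⊗ ω_z`. -/
def alt3 {q : ℝ} (f : H q) : T3 q
  | .minus, .plus, .z => f
  | .plus, .minus, .z => -f
  | .z, .minus, .plus => f
  | .minus, .z, .plus => -f
  | .plus, .z, .minus => f
  | .z, .plus, .minus => -f
  | _, _, _ => 0

/-- The coordinates of `A⁽²⁾ t`. -/
def coord2 {q : ℝ} (t : T2 q) : Idx → H q
  | .minus => t .minus .z - (q : ℂ) ^ 2 • t .z .minus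
  | .z => t .minus .plus - (q : ℂ) ^ 2 • t .plus .minus + skew q • t .z .z
  | .plus => t .z .plus - (q : ℂ) ^ 2 • t .plus .z

/-- The coordinate of `A⁽³⁾ t`. -/
def coord3 {q : ℝ} (t : T3 q) : H q :=
  (q : ℂ) ^ 2 • (t .minus .plus .z + t .z .minus .plus + skew q • t .z .z .z) - t .minus .z .plus -
    (q : ℂ) ^ 4 • (t .z .plus .minus + t .plus .minus .z) + (q : ℂ) ^ 6 • t .plus .z .minus

/-- For two distinct labels, 1 - σ sends the two orderings to 1 and -q² times the same antisymmetric
tensor. It sends ω_z ⊗ ω_z to a multiple of ω_- ⊗ ω_+ - ω_+ ⊗ ω_- and kills the other two squares.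
-/
theorem A2_eq (q : ℝ) (t : T2 q) : A2 q t = alt2 (coord2 t) := by
  have e : A2 q t = t - sigma q t := rfl
  have hs : 2 * (q : ℂ) * ((q : ℂ) - 1) / (1 + (q : ℂ)⁻¹) = skew q := rfl
  rw [e]
  ext k s
  simp only [Pi.sub_apply, sigma, LinearMap.coe_mk, AddHom.coe_mk, sum_idx, braid, hs]
  cases k <;> cases s <;>
    simp only [e2, alt2, coord2, and_true, and_false, if_true, if_false, reduceCtorEq] <;> module

theorem sigma1_apply (q : ℝ) (t : T3 q) (k s r : Idx) :
    sigma1 q t k s r = sigma q (fun a b => t a b r) k s := rfl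

theorem sigma2_apply (q : ℝ) (t : T3 q) (k s r : Idx) :
    sigma2 q t r k s = sigma q (t r) k s := rfl

theorem sigma_eq (q : ℝ) (t : T2 q) (k s : Idx) : sigma q t k s = t k s - alt2 (coord2 t) k s := by
  rw [← A2_eq]
  have e : A2 q t = t - sigma q t := rfl
  simp [e]

/-- Replacing σ by 1 minus the explicit antisymmetriser turns each of the 27 components into a
polynomial identity in `q` and `skew q`. The value of `skew q` plays no role here. -/
theorem A3_eq (q : ℝ) (t : T3 q) : A3 q t = alt3 (coord3 t) := by
  have e : A3 q t = (t - sigma1 q t + sigma1 q (sigma2 q t)) -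
    sigma2 q (t - sigma1 q t + sigma1 q (sigma2 q t)) := rfl
  rw [e]
  ext k s r
  simp only [Pi.sub_apply, sigma2_apply, sigma_eq]
  cases k <;> cases s <;> cases r <;>
    simp only [alt2, alt3, coord2, coord3, Pi.sub_apply, Pi.add_apply, sigma1_apply, sigma2_apply,
      sigma_eq] <;> module

theorem alt2_mem {q : ℝ} (g : Idx → H q) : alt2 g ∈ G2 q := by
  -- The preimage is supported on the orderings that enter `coord2` with coefficient 1, so nothing
  -- has to be inverted.
  refine ⟨fun | .minus, .z => g .minus | .minus, .plus => g .z | .z, .plus => g .plus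
              | _, _ => 0, ?_⟩
  rw [A2_eq]
  congr 1
  ext a
  cases a <;> simp [coord2]

theorem alt3_mem {q : ℝ} (h : H q) : alt3 h ∈ G3 q := by
  -- This ordering has coefficient -1 in `coord3`; the others carry a power of `q`.
  refine ⟨fun | .minus, .z, .plus => -h | _, _, _ => 0, ?_⟩
  rw [A3_eq]
  congr 1
  simp [coord3]

/-- The two-form with given coordinates. -/
def mk2 {q : ℝ} (g : Idx → H q) : G2 q := ⟨alt2 g, alt2_mem g⟩

/-- The three-form with given coordinate. -/
def mk3 {q : ℝ} (h : H q) : G3 q := ⟨alt3 h, alt3_mem h⟩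

theorem exists_mk2 {q : ℝ} (η : G2 q) : ∃ g, η = mk2 g := by
  obtain ⟨_, t, rfl⟩ := η
  exact ⟨coord2 t, Subtype.ext (A2_eq q t)⟩

theorem rangeRestrict_A2 {q : ℝ} (t : T2 q) : (A2 q).rangeRestrict t = mk2 (coord2 t) :=
  Subtype.ext (A2_eq q t)

theorem rangeRestrict_A3 {q : ℝ} (t : T3 q) : (A3 q).rangeRestrict t = mk3 (coord3 t) :=
  Subtype.ext (A3_eq q t)

theorem alt2_injective {q : ℝ} : Function.Injective (alt2 : (Idx → H q) → T2 q) := by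
  intro g g' h
  ext a
  cases a
  · exact congrFun (congrFun h .minus) .z
  · exact congrFun (congrFun h .minus) .plus
  · exact congrFun (congrFun h .z) .plus

theorem mk2_injective {q : ℝ} : Function.Injective (mk2 : (Idx → H q) → G2 q) :=
  fun _ _ h => alt2_injective (congrArg Subtype.val h)

theorem smul_mk2 {q : ℝ} (x : H q) (g : Idx → H q) : x • mk2 g = mk2 (x • g) := by
  apply Subtype.ext
  ext a b
  cases a <;> cases b <;> simp [mk2, alt2]

theorem csmul_mk2 {q : ℝ} (r : ℂ) (g : Idx → H q) : r • mk2 g = mk2 (r • g) := by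
  apply Subtype.ext
  ext a b
  cases a <;> cases b <;> simp [mk2, alt2]

theorem mk2_add {q : ℝ} (g g' : Idx → H q) : mk2 g + mk2 g' = mk2 (g + g') := by
  apply Subtype.ext
  ext a b
  cases a <;> cases b <;> simp [mk2, alt2, add_comm]

theorem smul_mk3 {q : ℝ} (x h : H q) : x • mk3 h = mk3 (x * h) := by
  apply Subtype.ext
  ext a b c
  cases a <;> cases b <;> cases c <;> simp [mk3, alt3]

theorem csmul_mk3 {q : ℝ} (r : ℂ) (h : H q) : r • mk3 h = mk3 (r • h) := by
  apply Subtype.ext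
  ext a b c
  cases a <;> cases b <;> cases c <;> simp [mk3, alt3]

theorem mk3_add {q : ℝ} (h h' : H q) : mk3 h + mk3 h' = mk3 (h + h') := by
  apply Subtype.ext
  ext a b c
  cases a <;> cases b <;> cases c <;> simp [mk3, alt3, add_comm]

theorem lam2_ne_zero (q : ℝ) : (lam2 q : ℂ) ≠ 0 := by
  have h : 0 < lam2 q := by unfold lam2; positivity
  exact_mod_cast h.ne'

theorem lam3_pos (q : ℝ) : 0 < lam3 q := by unfold lam3; positivity

theorem lam3_ne_zero (q : ℝ) : (lam3 q : ℂ) ≠ 0 := by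
  exact_mod_cast (lam3_pos q).ne'

/-- The factor q² is the coefficient of ω_- ⊗ ω_+ ⊗ ω_z in `coord3`. -/
theorem tau_eq (q δ : ℝ) :
    tau q δ = mk3 (algebraMap ℂ (H q) (Complex.I * δ * (q : ℂ) ^ 2)) := by
  rw [tau, theta, rangeRestrict_A3, csmul_mk3]
  congr 1
  simp only [coord3, and_true, and_false, if_true, if_false, reduceCtorEq,
    Algebra.algebraMap_eq_smul_one]
  module

/-! ### The differential and the Hodge operator in coordinates -/

/-- The coordinates of `d t` for a one-form `t`. -/
def d1Coord {q : ℝ} (t : T1 q) : Idx → H q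
  | .minus => X q .minus (t .z) - (q : ℂ) ^ 2 • X q .z (t .minus) +
      (Complex.I * ((1 + (q : ℂ)) / 2)) • t .minus
  | .z => X q .minus (t .plus) - (q : ℂ) ^ 2 • X q .plus (t .minus) + skew q • X q .z (t .z) -
      (Complex.I * (2 * (q : ℂ) ^ 2 / (1 + (q : ℂ)))) • t .z
  | .plus => X q .z (t .plus) - (q : ℂ) ^ 2 • X q .plus (t .z) +
      (Complex.I * ((1 + (q : ℂ)) / 2)) • t .plus

theorem d1_eq {q : ℝ} (t : T1 q) : d1 q t = mk2 (d1Coord t) := by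
  simp only [d1, LinearMap.comp_apply, LinearMap.restrictScalars_apply, rangeRestrict_A2,
    LinearMap.coe_mk, AddHom.coe_mk]
  congr 1
  -- On the antisymmetric structure constants `coord2` produces a factor 1 + q² = λ₂, which cancels
  -- the normalisation in `mc`.
  have h : (lam2 q : ℂ)⁻¹ * (1 + (q : ℂ) ^ 2) = 1 := by
    have := lam2_ne_zero q
    rw [inv_mul_eq_one₀ this]
    simp [lam2]
  ext a
  cases a <;> simp only [coord2, d1Coord, sum_idx, mc, struct] <;>
    generalize (lam2 q : ℂ)⁻¹ = l at h ⊢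
  · trans X q .minus (t .z) - (q : ℂ) ^ 2 • X q .z (t .minus) +
      ((l * (1 + (q : ℂ) ^ 2)) * (Complex.I * ((1 + (q : ℂ)) / 2))) • t .minus
    · module
    · rw [h, one_mul]
  · trans X q .minus (t .plus) - (q : ℂ) ^ 2 • X q .plus (t .minus) + skew q • X q .z (t .z) -
      ((l * (1 + (q : ℂ) ^ 2)) * (Complex.I * (2 * (q : ℂ) ^ 2 / (1 + (q : ℂ))))) • t .z
    · module
    · rw [h, one_mul]
  · trans X q .z (t .plus) - (q : ℂ) ^ 2 • X q .plus (t .z) +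
      ((l * (1 + (q : ℂ) ^ 2)) * (Complex.I * ((1 + (q : ℂ)) / 2))) • t .plus
    · module
    · rw [h, one_mul]

/-- The structure constants cancel, so left invariant two-forms are closed. Each derivative occurs
for both orderings of the remaining labels, with weights in the ratio 1 : q², and their sum absorbs
1/λ₂. -/
theorem d2_mk2 {q : ℝ} (g : Idx → H q) :
    d2 q (mk2 g) = mk3 (-X q .minus (g .plus) + (q : ℂ) ^ 2 • X q .z (g .z) -
      (q : ℂ) ^ 4 • X q .plus (g .minus)) := by
  simp only [d2, LinearMap.smul_apply, LinearMap.comp_apply, LinearMap.restrictScalars_apply,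
    rangeRestrict_A3, LinearMap.coe_mk, AddHom.coe_mk, csmul_mk3, Submodule.subtype_apply, mk2]
  congr 1
  have h : (lam2 q : ℂ)⁻¹ * (1 + (q : ℂ) ^ 2) = 1 := by
    have := lam2_ne_zero q
    rw [inv_mul_eq_one₀ this]
    simp [lam2]
  simp only [coord3, alt2, sum_idx, mc, struct, map_neg, map_zero]
  generalize (lam2 q : ℂ)⁻¹ = l at h
  trans (l * (1 + (q : ℂ) ^ 2)) • (-X q .minus (g .plus) + (q : ℂ) ^ 2 • X q .z (g .z) -
      (q : ℂ) ^ 4 • X q .plus (g .minus))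
  · module
  · rw [h, one_smul]

/-- The coordinates of `⋆t` for a one-form `t`. -/
def star1Coord {q : ℝ} (α β γ δ : ℝ) (t : T1 q) : Idx → H q
  | .minus => -(Complex.I * δ * (q : ℂ) ^ 2 * α) • t .minus
  | .z => (Complex.I * δ * (q : ℂ) ^ 2 * γ) • t .z
  | .plus => -(Complex.I * δ * (q : ℂ) ^ 2 * β) • t .plus

theorem S1_eq {q : ℝ} (α β γ δ : ℝ) (t : T1 q) :
    S1 q α β γ δ t = mk2 (star1Coord α β γ δ t) := by
  apply Subtype.ext
  simp only [S1, LinearMap.coe_mk, AddHom.coe_mk, mk2, sum_idx, tau_eq, mk3]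
  ext a b
  simp only [Pi.add_apply, Pi.smul_apply]
  cases a <;> cases b <;>
    simp only [metric, alt2, alt3, star1Coord, Algebra.algebraMap_eq_smul_one, smul_eq_mul,
      mul_zero, mul_neg, mul_smul_comm, mul_one] <;> module

/-- The coefficients of `⋆η` for a two-form `η` with given coordinates. -/
def star2Coeff {q : ℝ} (α β γ δ : ℝ) (g : Idx → H q) : T1 q
  | .minus => ((lam2 q : ℂ)⁻¹ * (2 * α * γ * (Complex.I * δ * (q : ℂ) ^ 2))) • g .minus
  | .z => -((lam2 q : ℂ)⁻¹ * (2 * α * β * (Complex.I * δ * (q : ℂ) ^ 2))) • g .z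
  | .plus => ((lam2 q : ℂ)⁻¹ * (2 * β * γ * (Complex.I * δ * (q : ℂ) ^ 2))) • g .plus

theorem S2_mk2 {q : ℝ} (α β γ δ : ℝ) (g : Idx → H q) :
    S2 q α β γ δ (mk2 g) = star2Coeff α β γ δ g := by
  ext k
  simp only [S2, LinearMap.coe_mk, AddHom.coe_mk, mk2, sum_idx, tau_eq, mk3]
  cases k <;>
    simp only [metric, alt2, alt3, star2Coeff, Algebra.algebraMap_eq_smul_one,
      mul_zero, zero_mul, mul_neg, mul_smul_comm, mul_one] <;> module

/-- The 6 counts the orderings of three labels. The minus sign arises because the metric pairs `-`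
with `+`, an odd permutation of the labels. -/
theorem S3_mk3 {q : ℝ} (α β γ δ : ℝ) (h : H q) :
    S3 q α β γ δ (mk3 h) =
      -((lam3 q : ℂ)⁻¹ * (6 * α * β * γ * (Complex.I * δ * (q : ℂ) ^ 2))) • h := by
  simp only [S3, LinearMap.coe_mk, AddHom.coe_mk, mk3, sum_idx, tau_eq]
  simp only [metric, alt3, Algebra.algebraMap_eq_smul_one,
      mul_zero, zero_mul, zero_smul, smul_zero, add_zero, zero_add, mul_neg,
      mul_smul_comm, mul_one]
  module

/-- The form with given coordinates. -/
def form {q : ℝ} (f : H q) (t : T1 q) (g : Idx → H q) (h : H q) : Form q := (f, t, mk2 g, mk3 h)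

theorem S0_eq {q : ℝ} (δ : ℝ) (f : H q) :
    S0 q δ f = mk3 ((Complex.I * δ * (q : ℂ) ^ 2) • f) := by
  simp only [S0, LinearMap.coe_mk, AddHom.coe_mk, tau_eq, smul_mk3,
    Algebra.algebraMap_eq_smul_one, mul_smul_comm, mul_one]

theorem mk2_zero {q : ℝ} : (mk2 0 : G2 q) = 0 := by
  apply Subtype.ext
  ext a b
  cases a <;> cases b <;> simp [mk2, alt2]

theorem mk3_zero {q : ℝ} : (mk3 0 : G3 q) = 0 := by
  apply Subtype.ext
  ext a b c
  cases a <;> cases b <;> cases c <;> simp [mk3, alt3]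

theorem star_form {q : ℝ} (α β γ δ : ℝ) (f : H q) (t : T1 q) (g : Idx → H q) (h : H q) :
    star q α β γ δ (form f t g h) =
      form (-((lam3 q : ℂ)⁻¹ * (6 * α * β * γ * (Complex.I * δ * (q : ℂ) ^ 2))) • h)
        (star2Coeff α β γ δ g) (star1Coord α β γ δ t) ((Complex.I * δ * (q : ℂ) ^ 2) • f) := by
  simp only [star, form, LinearMap.coe_mk, AddHom.coe_mk, S0_eq, S1_eq, S2_mk2, S3_mk3]

theorem extd_form {q : ℝ} (f : H q) (t : T1 q) (g : Idx → H q) (h : H q) :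
    extd q (form f t g h) = form 0 (fun a => X q a f) (d1Coord t)
      (-X q .minus (g .plus) + (q : ℂ) ^ 2 • X q .z (g .z) -
        (q : ℂ) ^ 4 • X q .plus (g .minus)) := by
  simp only [extd, form, LinearMap.coe_mk, AddHom.coe_mk, d1_eq, d2_mk2]
  rfl

theorem scale_form {q : ℝ} (ε : ℕ → ℂ) (f : H q) (t : T1 q) (g : Idx → H q) (h : H q) :
    scale q ε (form f t g h) = form (ε 0 • f) (ε 1 • t) (ε 2 • g) (ε 3 • h) := by
  simp only [scale, form, LinearMap.coe_mk, AddHom.coe_mk, csmul_mk2, csmul_mk3]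

theorem smul_form {q : ℝ} (x f : H q) (t : T1 q) (g : Idx → H q) (h : H q) :
    x • form f t g h = form (x * f) (x • t) (x • g) (x * h) := by
  simp only [form, Prod.smul_mk, smul_mk2, smul_mk3, smul_eq_mul]

theorem csmul_form {q : ℝ} (r : ℂ) (f : H q) (t : T1 q) (g : Idx → H q) (h : H q) :
    r • form f t g h = form (r • f) (r • t) (r • g) (r • h) := by
  simp only [form, Prod.smul_mk, csmul_mk2, csmul_mk3]

theorem form_add {q : ℝ} (f f' : H q) (t t' : T1 q) (g g' : Idx → H q) (h h' : H q) :
    form f t g h + form f' t' g' h' = form (f + f') (t + t') (g + g') (h + h') := by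
  simp only [form, Prod.mk_add_mk, mk2_add, mk3_add]

theorem omega_eq (q : ℝ) (a : Idx) : omega q a = form 0 (om q a) 0 0 := by
  simp only [omega, form, mk2_zero, mk3_zero]

theorem unit_eq (q : ℝ) : unit q = form 1 0 0 0 := by
  simp only [unit, form, mk2_zero, mk3_zero]

theorem vol_eq (q δ : ℝ) :
    vol q δ = form 0 0 0 ((Complex.I * δ * (q : ℂ) ^ 2) • (1 : H q)) := by
  simp only [vol, form, mk2_zero, tau_eq, Algebra.algebraMap_eq_smul_one]

/-! ### Cartan-Killing parameters -/

/-- The counit separates 0 from 1. Nontriviality lets `smul_one_inj` turn identities between left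
invariant forms into scalar equations. -/
instance (q : ℝ) : Nontrivial (H q) := by
  refine ⟨⟨0, 1, fun h => ?_⟩⟩
  have h1 := congrArg (H.lift q epsGen (epsGen_unitary q)) h
  rw [map_zero, map_one] at h1
  exact zero_ne_one h1

theorem smul_one_inj {q : ℝ} {r s : ℂ} : r • (1 : H q) = s • 1 ↔ r = s := by
  simpa only [Algebra.algebraMap_eq_smul_one] using
    (FaithfulSMul.algebraMap_injective ℂ (H q)).eq_iff (a := r) (b := s)

theorem conv_apply_of_comul {q : ℝ} (f g : Dual q) {x : H q} {t : H q ⊗[ℂ] H q}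
    (h : comul q x = t) : conv f g x = LinearMap.mul' ℂ ℂ (TensorProduct.map f g t) := by
  rw [← h]; rfl

theorem act_apply_of_comul {q : ℝ} (f : Dual q) {x : H q} {t : H q ⊗[ℂ] H q}
    (h : comul q x = t) :
    act f x = TensorProduct.rid ℂ (H q) (LinearMap.lTensor (H q) f t) := by
  rw [← h]; rfl

theorem conv_one {q : ℝ} (f g : Dual q) : conv f g 1 = f 1 * g 1 := by
  rw [conv_apply_of_comul f g (map_one (comul q)), Algebra.TensorProduct.one_def]
  simp

theorem act_one {q : ℝ} (f : Dual q) : act f 1 = f 1 • 1 := by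
  rw [act_apply_of_comul f (map_one (comul q)), Algebra.TensorProduct.one_def]
  simp

theorem triCoeff_apply {q : ℝ} (hq : 0 < q) (e : ℂ × ℂ) (i j : Fin 2) (x : H q) :
    triCoeff q e i j x = H.lift q (triGen q e) (triGen_unitary hq e) x i j := by
  simp [triCoeff, hq]

theorem tangent_one {q : ℝ} (hq : 0 < q) (a : Idx) : tangent q a 1 = 0 := by
  cases a <;> simp [tangent, conv_one, E, F, Kinv, eps, triCoeff_apply hq]

theorem X_one {q : ℝ} (hq : 0 < q) (a : Idx) : X q a 1 = 0 := by
  rw [X, act_one, tangent_one hq, zero_smul]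

theorem form_inj {q : ℝ} {f f' : H q} {t t' : T1 q} {g g' : Idx → H q} {h h' : H q}
    (hf : f = f') (ht : t = t') (hg : g = g') (hh : h = h') :
    form f t g h = form f' t' g' h' := by
  rw [hf, ht, hg, hh]

/-- The coefficients of ω_a are constants, so only the Maurer-Cartan term of dω_a survives. Both
sides are then diagonal in the label, with a common factor i. -/
theorem killing_iff {q : ℝ} (hq : 0 < q) (α β γ δ ξ : ℝ) :
    (∀ a : Idx, star q α β γ δ (omega q a) = (ξ : ℂ) • extd q (omega q a)) ↔
      δ * q ^ 2 * α = -(ξ * ((1 + q) / 2)) ∧ δ * q ^ 2 * β = -(ξ * ((1 + q) / 2)) ∧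
        δ * q ^ 2 * γ = -(ξ * (2 * q ^ 2 / (1 + q))) := by
  have key : ∀ a : Idx, star q α β γ δ (omega q a) = (ξ : ℂ) • extd q (omega q a) ↔
      star1Coord α β γ δ (om q a) = (ξ : ℂ) • d1Coord (om q a) := by
    intro a
    rw [omega_eq, star_form, extd_form, csmul_form]
    constructor
    · intro h
      have h1 : mk2 (star1Coord α β γ δ (om q a)) = mk2 ((ξ : ℂ) • d1Coord (om q a)) :=
        congrArg (fun w : Form q => w.2.2.1) h
      exact mk2_injective h1
    · intro h
      rw [h]
      refine form_inj (by simp) ?_ rfl (by simp)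
      ext b
      cases b <;> simp [star2Coeff]
  simp only [key, funext_iff]
  have e1 : ∀ r s : ℝ, ((r : ℂ) = s ↔ r = s) := fun r s => Complex.ofReal_inj
  constructor
  · intro h
    have h1 := h .minus .minus
    have h2 := h .plus .plus
    have h3 := h .z .z
    simp only [star1Coord, d1Coord, Pi.smul_apply, om, if_true, if_false, reduceCtorEq, X_one hq,
      map_zero, smul_zero, sub_zero, zero_add, zero_sub, ← neg_smul, smul_smul,
      smul_one_inj] at h1 h2 h3
    refine ⟨?_, ?_, ?_⟩
    · rw [← e1]
      push_cast
      linear_combination Complex.I * h1 + (ξ * ((1 + q) / 2) + δ * q ^ 2 * α) * Complex.I_mul_I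
    · rw [← e1]
      push_cast
      linear_combination Complex.I * h2 + (ξ * ((1 + q) / 2) + δ * q ^ 2 * β) * Complex.I_mul_I
    · rw [← e1]
      push_cast
      linear_combination -Complex.I * h3 +
        (ξ * (2 * q ^ 2 / (1 + q)) + δ * q ^ 2 * γ) * Complex.I_mul_I
  · rintro ⟨h1, h2, h3⟩ a b
    rw [← e1] at h1 h2 h3
    push_cast at h1 h2 h3
    cases a <;> cases b <;>
      simp only [star1Coord, d1Coord, Pi.smul_apply, om, if_true, if_false, reduceCtorEq, X_one hq,
        map_zero, smul_zero, sub_zero, zero_add, zero_sub, add_zero, ← neg_smul, smul_smul,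
        smul_one_inj]
    · linear_combination -Complex.I * h1
    · linear_combination Complex.I * h3
    · linear_combination -Complex.I * h2

theorem normalised_iff (q α β γ δ : ℝ) :
    star q α β γ δ (vol q δ) = unit q ↔ 6 * α * β * γ * (δ * q ^ 2) ^ 2 = lam3 q := by
  have h0 := lam3_ne_zero q
  rw [vol_eq, unit_eq, star_form]
  have key : -((lam3 q : ℂ)⁻¹ * (6 * α * β * γ * (Complex.I * δ * (q : ℂ) ^ 2))) •
      (Complex.I * δ * (q : ℂ) ^ 2) • (1 : H q) = 1 ↔
      6 * α * β * γ * (δ * q ^ 2) ^ 2 = lam3 q := by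
    rw [smul_smul, ← one_smul ℂ (1 : H q), smul_smul, mul_one, smul_one_inj,
      ← Complex.ofReal_inj]
    push_cast
    have e : -((lam3 q : ℂ)⁻¹ * (6 * α * β * γ * (Complex.I * δ * (q : ℂ) ^ 2))) *
        (Complex.I * δ * (q : ℂ) ^ 2) =
        (lam3 q : ℂ)⁻¹ * (6 * α * β * γ * (δ * q ^ 2) ^ 2) := by
      linear_combination -(lam3 q : ℂ)⁻¹ * (6 * α * β * γ * (δ * q ^ 2) ^ 2) * Complex.I_mul_I
    rw [e, inv_mul_eq_one₀ h0, eq_comm]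
  rw [← key]
  constructor
  · exact fun h => congrArg (fun w : Form q => w.1) h
  · intro h
    refine form_inj h ?_ ?_ (by simp) <;> ext b <;> cases b <;> simp [star2Coeff, star1Coord]

theorem isCartanKilling_iff {q : ℝ} (hq : 0 < q) (α β γ δ ξ : ℝ) :
    IsCartanKilling q α β γ δ ξ ↔
      0 < α ∧ β = α ∧ γ = (2 * q / (1 + q)) ^ 2 * α ∧
        δ = (1 + q) / (2 * q ^ 3) * Real.sqrt (lam3 q / 6) / (α * Real.sqrt α) ∧
        ξ = -(q⁻¹ * Real.sqrt (lam3 q / 6) / Real.sqrt α) := by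
  have hl := lam3_pos q
  set S := Real.sqrt (lam3 q / 6) with hS
  have hS0 : 0 < S := Real.sqrt_pos.2 (by positivity)
  have hS2 : S ^ 2 = lam3 q / 6 := Real.sq_sqrt (by positivity)
  constructor
  · rintro ⟨h1, h2, h3, h4, h5⟩
    rw [killing_iff hq] at h4
    rw [normalised_iff] at h5
    obtain ⟨ha, hb, hc⟩ := h4
    have hP : δ * q ^ 2 ≠ 0 := mul_ne_zero h2 (by positivity)
    have hβ : β = α := mul_left_cancel₀ hP (hb.trans ha.symm)
    have hγ : γ = (2 * q / (1 + q)) ^ 2 * α := by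
      apply mul_left_cancel₀ hP
      have e : δ * q ^ 2 * ((2 * q / (1 + q)) ^ 2 * α) =
          (2 * q / (1 + q)) ^ 2 * (δ * q ^ 2 * α) := by ring
      rw [hc, e, ha]
      field_simp
    subst hβ
    -- After β = α and the formula for γ, the normalisation becomes a square times the one remaining
    -- metric parameter, which `subst` has left under the name `β`. Positivity of λ₃ then gives
    -- `hβ0`.
    have h6 : 6 * ((2 * q / (1 + q)) * (δ * q ^ 2) * β) ^ 2 * β = lam3 q := by
      rw [← h5, hγ]; ring
    have hβ0 : 0 < β := by
      by_contra hn
      nlinarith [mul_nonneg (sq_nonneg ((2 * q / (1 + q)) * (δ * q ^ 2) * β))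
        (sub_nonneg.2 (not_lt.1 hn))]
    have hδ0 : 0 < δ := by
      have h7 : 0 < δ * q ^ 2 * β := by rw [ha]; nlinarith
      by_contra hn
      have : δ * (q ^ 2 * β) ≤ 0 := mul_nonpos_of_nonpos_of_nonneg (not_lt.1 hn) (by positivity)
      linarith
    have hr : 0 < Real.sqrt β := Real.sqrt_pos.2 hβ0
    have hr2 : Real.sqrt β ^ 2 = β := Real.sq_sqrt hβ0.le
    -- The normalisation determines only δ²; since both sides are positive, comparing squares
    -- suffices.
    have hδ : δ = (1 + q) / (2 * q ^ 3) * S / (β * Real.sqrt β) := by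
      rw [← sq_eq_sq₀ hδ0.le (by positivity), div_pow, mul_pow, mul_pow, hS2, hr2, ← h6]
      field_simp
    refine ⟨hβ0, rfl, hγ, hδ, ?_⟩
    have e : ξ = -(2 / (1 + q) * (δ * q ^ 2 * β)) := by
      rw [ha]; field_simp
    rw [e, hδ]
    field_simp
  · rintro ⟨hα, rfl, hγ, hδ, hξ⟩
    have hr : 0 < Real.sqrt β := Real.sqrt_pos.2 hα
    have hr2 : Real.sqrt β ^ 2 = β := Real.sq_sqrt hα.le
    have hδ0 : 0 < δ := by rw [hδ]; positivity
    refine ⟨by rw [hγ]; positivity, hδ0.ne', ?_, (killing_iff hq _ _ _ _ _).2 ⟨?_, ?_, ?_⟩,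
      (normalised_iff _ _ _ _ _).2 ?_⟩
    · rw [hξ]; exact neg_neg_of_pos (by positivity)
    · rw [hδ, hξ]; field_simp
    · rw [hδ, hξ]; field_simp
    · rw [hδ, hξ, hγ]; field_simp
    · have e : lam3 q = 6 * S ^ 2 := by rw [hS2]; ring
      rw [e, hδ, hγ]
      field_simp
      rw [hr2]

/-! ### The Hodge - de Rham operator on spinors -/

/-- These substitutions eliminate all parameters but q, α and ξ. Using ξ as an independent variable
avoids the square roots and leaves identities that `field_simp` and `ring` can decide. -/
theorem IsCartanKilling.scalars {q α β γ δ ξ : ℝ} (hq : 0 < q)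
    (h : IsCartanKilling q α β γ δ ξ) :
    ((ξ : ℂ) ≠ 0 ∧ (α : ℂ) ≠ 0) ∧ (β : ℂ) = α ∧
      (γ : ℂ) = (2 * q / (1 + q)) ^ 2 * α ∧ (δ : ℂ) = -(ξ * (1 + q) / (2 * q ^ 2 * α)) ∧
      (lam3 q : ℂ) = 6 * ξ ^ 2 * q ^ 2 * α := by
  have hξ := h.neg
  obtain ⟨hα, hβ, hγ, -, -⟩ := (isCartanKilling_iff hq _ _ _ _ _).1 h
  have h1 := ((killing_iff hq _ _ _ _ _).1 h.killing).1
  have h2 := (normalised_iff _ _ _ _ _).1 h.normalised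
  have hδ : δ = -(ξ * (1 + q) / (2 * q ^ 2 * α)) := by
    field_simp
    linear_combination 2 * h1
  refine ⟨⟨by exact_mod_cast hξ.ne, by exact_mod_cast hα.ne'⟩, by rw [hβ], ?_, ?_, ?_⟩
  · rw [hγ]; push_cast; rfl
  · rw [hδ]; push_cast; rfl
  · have e : lam3 q = 6 * ξ ^ 2 * q ^ 2 * α := by
      rw [← h2, hβ, hγ, hδ]
      field_simp
    rw [e]; push_cast; rfl

theorem star_star_one_two {q α β γ δ ξ : ℝ} (hq : 0 < q) (h : IsCartanKilling q α β γ δ ξ)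
    (t : T1 q) (η : G2 q) :
    star q α β γ δ (star q α β γ δ (0, t, η, 0)) =
      ((coefA q : ℝ) : ℂ) • ((0, t, η, 0) : Form q) := by
  obtain ⟨⟨hξ, hα⟩, hβ, hγ, hδ, h3⟩ := h.scalars hq
  obtain ⟨g, rfl⟩ := exists_mk2 η
  have h2 := lam2_ne_zero q
  have hq0 : (q : ℂ) ≠ 0 := by exact_mod_cast hq.ne'
  have hq1 : (1 + (q : ℂ)) ≠ 0 := by exact_mod_cast (by positivity : 1 + q ≠ 0)
  have hA : (coefA q : ℂ) = 2 * ξ ^ 2 * q ^ 2 * α / lam2 q := by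
    rw [coefA]; push_cast; rw [h3]; field_simp
  rw [← mk3_zero]
  change star q α β γ δ (star q α β γ δ (form 0 t g 0)) = _ • form 0 t g 0
  rw [star_form, star_form, csmul_form]
  refine form_inj (by simp) ?_ ?_ (by simp) <;> ext a <;> cases a <;>
    simp only [star1Coord, star2Coeff, Pi.smul_apply, smul_smul] <;> congr 1 <;>
    simp only [hA, hγ, hβ, hδ] <;> field_simp <;> rw [Complex.I_sq] <;> norm_num

theorem spinorBasis_sum {q : ℝ} (α β γ δ : ℝ) (ε : ℕ → ℂ) (κ : ℂ) (hε : ε 3 = 1)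
    (f : Fin 4 → H q) :
    ∑ j, f j • spinorBasis q α β γ δ ε κ j =
      form (f 0) (fun | .minus => f 1 | .z => f 2 | .plus => f 3)
        (fun | .minus => -(κ * (Complex.I * δ * (q : ℂ) ^ 2 * α)) • f 1
             | .z => (κ * (Complex.I * δ * (q : ℂ) ^ 2 * γ)) • f 2
             | .plus => -(κ * (Complex.I * δ * (q : ℂ) ^ 2 * β)) • f 3)
        ((κ * (Complex.I * δ * (q : ℂ) ^ 2)) • f 0) := by
  simp only [Fin.sum_univ_four, spinorBasis, Matrix.cons_val, psi0, phi, omega_eq, unit_eq, vol_eq,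
    star_form, csmul_form, form_add, smul_form, hε, one_mul]
  apply form_inj
  · simp
  · ext a
    cases a <;> simp [om, star2Coeff]
  · ext a
    cases a <;> simp [om, star1Coord, smul_smul]
  · simp [smul_smul]

/-- The components of a combination in degrees 0 and 1 are its coefficients themselves. -/
theorem linearIndependent_spinorBasis {q : ℝ} (α β γ δ : ℝ) (ε : ℕ → ℂ) (κ : ℂ) (hε : ε 3 = 1) :
    LinearIndependent (H q) (spinorBasis q α β γ δ ε κ) := by
  rw [Fintype.linearIndependent_iff]
  intro f hf
  rw [spinorBasis_sum _ _ _ _ _ _ hε] at hf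
  have h0 : f 0 = 0 := congrArg (fun w : Form q => w.1) hf
  have h1 : f 1 = 0 := congrArg (fun w : Form q => w.2.1 .minus) hf
  have h2 : f 2 = 0 := congrArg (fun w : Form q => w.2.1 .z) hf
  have h3 : f 3 = 0 := congrArg (fun w : Form q => w.2.1 .plus) hf
  intro i
  fin_cases i <;> assumption

/-- The diagonal operators of the lower block come from `d1Coord`: pulling (1+q)/2 out of the `-`
and `+` coordinates leaves i - (2q²/(1+q))X_z and i + (2/(1+q))X_z. In the `z` coordinate `skew q` =
-(1-q)·2q²/(1+q), and pulling out -2q²/(1+q) leaves i + (1-q)X_z. -/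
theorem dirac_spinor {q α β γ δ ξ : ℝ} (hq : 0 < q) (h : IsCartanKilling q α β γ δ ξ)
    (ε : ℕ → ℂ) (κ : ℂ) (hε1 : ε 1 = 1) (hε3 : ε 3 = 1) (hε2 : ε 2 = -1)
    (hκ : κ = -Complex.I * ((coefA q : ℝ) : ℂ)⁻¹) (f : Fin 4 → H q) :
    dirac q α β γ δ ε (∑ j, f j • spinorBasis q α β γ δ ε κ j) =
      ∑ i, (∑ j, diracMatrix q α β γ ξ i j (f j)) • spinorBasis q α β γ δ ε κ i := by
  obtain ⟨⟨hξ, hα⟩, hβ, hγ, hδ, h3⟩ := h.scalars hq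
  have h2 := lam2_ne_zero q
  have hq0 : (q : ℂ) ≠ 0 := by exact_mod_cast hq.ne'
  have hq1 : (1 + (q : ℂ)) ≠ 0 := by exact_mod_cast (by positivity : 1 + q ≠ 0)
  have hq2 : ((q : ℂ) + 1) ≠ 0 := by rwa [add_comm]
  have hA : (coefA q : ℂ) = 2 * ξ ^ 2 * q ^ 2 * α / lam2 q := by
    rw [coefA]; push_cast; rw [h3]; field_simp
  have hl2 : (lam2 q : ℂ) = 1 + (q : ℂ) ^ 2 := by simp [lam2]
  have hl2' : (1 + (q : ℂ) ^ 2) ≠ 0 := by rwa [← hl2]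
  rw [spinorBasis_sum _ _ _ _ _ _ hε3, spinorBasis_sum _ _ _ _ _ _ hε3]
  simp only [dirac, LinearMap.add_apply, LinearMap.comp_apply, extd_form, scale_form, star_form,
    form_add, Fin.sum_univ_four, diracMatrix, Matrix.of_apply, Matrix.cons_val, hε1, hε2, hε3,
    one_smul, h3, hκ, hA]
  apply form_inj
  · simp only [star1Coord, LinearMap.smul_apply, LinearMap.zero_apply, map_smul, hγ, hβ, hδ]
    match_scalars <;> field_simp <;> (try simp only [Complex.I_sq]) <;> (try ring)
  · ext a
    cases a <;> simp only [star2Coeff, d1Coord, LinearMap.smul_apply,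
      LinearMap.zero_apply, LinearMap.add_apply, LinearMap.sub_apply, LinearMap.neg_apply,
      Module.End.one_apply, map_smul, Pi.smul_apply, Pi.add_apply, hγ, hβ, hδ, hl2, skew] <;>
      match_scalars <;> field_simp <;> (try simp only [Complex.I_pow_four]; try ring)
  · ext a
    cases a <;> simp only [star1Coord, d1Coord, LinearMap.smul_apply,
      LinearMap.zero_apply, LinearMap.add_apply, LinearMap.sub_apply, LinearMap.neg_apply,
      Module.End.one_apply, map_smul, Pi.add_apply, hγ, hβ, hδ, hl2, skew] <;>
      match_scalars <;> field_simp <;> (try simp only [Complex.I_sq]) <;> (try ring)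
  · simp only [LinearMap.smul_apply, LinearMap.zero_apply, map_smul, hγ, hβ, hδ]
    match_scalars <;> field_simp

theorem dirac_mem_spinors {q α β γ δ ξ : ℝ} (hq : 0 < q) (h : IsCartanKilling q α β γ δ ξ)
    (ε : ℕ → ℂ) (κ : ℂ) (hε1 : ε 1 = 1) (hε3 : ε 3 = 1) (hε2 : ε 2 = -1)
    (hκ : κ = -Complex.I * ((coefA q : ℝ) : ℂ)⁻¹) {ψ : Form q}
    (hψ : ψ ∈ spinors q α β γ δ ε κ) : dirac q α β γ δ ε ψ ∈ spinors q α β γ δ ε κ := by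
  obtain ⟨f, rfl⟩ := (Submodule.mem_span_range_iff_exists_fun (H q)).1 hψ
  rw [dirac_spinor hq h ε κ hε1 hε3 hε2 hκ]
  exact Submodule.sum_mem _ fun i _ =>
    Submodule.smul_mem _ _ (Submodule.subset_span (Set.mem_range_self i))

/-! ### The Leibniz rule for the tangent functionals -/

theorem comul_of (q : ℝ) (g : Gen) : comul q (H.of q g) = comulGen q g :=
  H.lift_of _ _ _ _

/-- Multiplicative functionals. -/
def IsMult {q : ℝ} (k : Dual q) : Prop := ∀ x y, k (x * y) = k x * k y

/-- Functionals `T` with `T(xy) = T(x) e(y) + k(x) T(y)`. -/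
def IsSkewDer {q : ℝ} (k e T : Dual q) : Prop := ∀ x y, T (x * y) = T x * e y + k x * T y

theorem IsMult.act {q : ℝ} {k : Dual q} (hk : IsMult k) (x y : H q) :
    act k (x * y) = act k x * act k y := by
  have key : ∀ s t : H q ⊗[ℂ] H q,
      TensorProduct.rid ℂ (H q) (LinearMap.lTensor (H q) k (s * t)) =
        TensorProduct.rid ℂ (H q) (LinearMap.lTensor (H q) k s) *
          TensorProduct.rid ℂ (H q) (LinearMap.lTensor (H q) k t) := by
    intro s t
    induction s using TensorProduct.induction_on with
    | zero => simp
    | add s s' hs hs' => rw [add_mul, map_add, map_add, hs, hs', map_add, map_add, add_mul]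
    | tmul s s' =>
      induction t using TensorProduct.induction_on with
      | zero => simp
      | add t t' ht ht' => rw [mul_add, map_add, map_add, ht, ht', map_add, map_add, mul_add]
      | tmul t t' => simp [hk s' t', smul_smul, mul_comm]
  rw [act_apply_of_comul k (map_mul (comul q) x y), key]
  rfl

/-- The coproduct is multiplicative, so the rule can be checked on pure tensors, where the values of
the functionals are scalars and commute with everything. -/
theorem IsSkewDer.act {q : ℝ} {k e T : Dual q} (hT : IsSkewDer k e T) (x y : H q) :
    act T (x * y) = act T x * act e y + act k x * act T y := by
  have key : ∀ s t : H q ⊗[ℂ] H q,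
      TensorProduct.rid ℂ (H q) (LinearMap.lTensor (H q) T (s * t)) =
        TensorProduct.rid ℂ (H q) (LinearMap.lTensor (H q) T s) *
          TensorProduct.rid ℂ (H q) (LinearMap.lTensor (H q) e t) +
        TensorProduct.rid ℂ (H q) (LinearMap.lTensor (H q) k s) *
          TensorProduct.rid ℂ (H q) (LinearMap.lTensor (H q) T t) := by
    intro s t
    induction s using TensorProduct.induction_on with
    | zero => simp
    | add s s' hs hs' => rw [add_mul]; simp only [map_add, add_mul, hs, hs']; abel
    | tmul s s' =>
      induction t using TensorProduct.induction_on with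
      | zero => simp
      | add t t' ht ht' => rw [mul_add]; simp only [map_add, mul_add, ht, ht']; abel
      | tmul t t' => simp [hT s' t', smul_smul, mul_comm, add_smul]
  rw [act_apply_of_comul T (map_mul (comul q) x y), key]
  rfl

theorem IsMult.conv {q : ℝ} {k l : Dual q} (hk : IsMult k) (hl : IsMult l) :
    IsMult (conv k l) := by
  intro x y
  have key : ∀ s t : H q ⊗[ℂ] H q,
      LinearMap.mul' ℂ ℂ (TensorProduct.map k l (s * t)) =
        LinearMap.mul' ℂ ℂ (TensorProduct.map k l s) *
          LinearMap.mul' ℂ ℂ (TensorProduct.map k l t) := by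
    intro s t
    induction s using TensorProduct.induction_on with
    | zero => simp
    | add s s' hs hs' => rw [add_mul]; simp only [map_add, add_mul, hs, hs']
    | tmul s s' =>
      induction t using TensorProduct.induction_on with
      | zero => simp
      | add t t' ht ht' => rw [mul_add]; simp only [map_add, mul_add, ht, ht']
      | tmul t t' => simp [hk s t, hl s' t']; ring
  rw [conv_apply_of_comul k l (map_mul (comul q) x y), key]
  rfl

/-- This carries the twisted Leibniz rules of E and F over to EK⁻¹ and FK⁻¹. -/
theorem IsSkewDer.conv {q : ℝ} {k e T l : Dual q} (hT : IsSkewDer k e T) (hl : IsMult l) :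
    IsSkewDer (conv k l) (conv e l) (conv T l) := by
  intro x y
  have key : ∀ s t : H q ⊗[ℂ] H q,
      LinearMap.mul' ℂ ℂ (TensorProduct.map T l (s * t)) =
        LinearMap.mul' ℂ ℂ (TensorProduct.map T l s) *
          LinearMap.mul' ℂ ℂ (TensorProduct.map e l t) +
        LinearMap.mul' ℂ ℂ (TensorProduct.map k l s) *
          LinearMap.mul' ℂ ℂ (TensorProduct.map T l t) := by
    intro s t
    induction s using TensorProduct.induction_on with
    | zero => simp
    | add s s' hs hs' => rw [add_mul]; simp only [map_add, add_mul, hs, hs']; ring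
    | tmul s s' =>
      induction t using TensorProduct.induction_on with
      | zero => simp
      | add t t' ht ht' => rw [mul_add]; simp only [map_add, mul_add, ht, ht']; ring
      | tmul t t' => simp [hT s t, hl s' t']; ring
  rw [conv_apply_of_comul T l (map_mul (comul q) x y), key]
  rfl

theorem IsSkewDer.smul {q : ℝ} {k e T : Dual q} (hT : IsSkewDer k e T) (r : ℂ) :
    IsSkewDer k e (r • T) := by
  intro x y
  simp only [LinearMap.smul_apply, hT x y, smul_eq_mul]
  ring

@[elab_as_elim]
theorem H.induction {q : ℝ} {p : H q → Prop} (scalar : ∀ r, p (algebraMap ℂ (H q) r))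
    (of : ∀ g, p (H.of q g)) (mul : ∀ x y, p x → p y → p (x * y))
    (add : ∀ x y, p x → p y → p (x + y)) (x : H q) : p x := by
  obtain ⟨y, rfl⟩ := RingQuot.mkAlgHom_surjective ℂ (Rel q) x
  refine FreeAlgebra.induction ℂ Gen
    (motive := fun y => p (RingQuot.mkAlgHom ℂ (Rel q) y)) (fun r => ?_) of
    (fun y z hy hz => ?_) (fun y z hy hz => ?_) y
  · rw [AlgHom.commutes]
    exact scalar r
  · rw [map_mul]
    exact mul _ _ hy hz
  · rw [map_add]
    exact add _ _ hy hz

theorem triCoeff_mul {q : ℝ} (hq : 0 < q) (e : ℂ × ℂ) (i j : Fin 2) (x y : H q) :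
    triCoeff q e i j (x * y) =
      triCoeff q e i 0 x * triCoeff q e 0 j y + triCoeff q e i 1 x * triCoeff q e 1 j y := by
  simp only [triCoeff_apply hq, map_mul, Matrix.mul_apply, Fin.sum_univ_two]

theorem triCoeff_of {q : ℝ} (hq : 0 < q) (e : ℂ × ℂ) (i j : Fin 2) (g : Gen) :
    triCoeff q e i j (H.of q g) = triGen q e g i j := by
  rw [triCoeff_apply hq, H.lift_of]

theorem triCoeff_algebraMap {q : ℝ} (hq : 0 < q) (e : ℂ × ℂ) (i j : Fin 2) (r : ℂ) :
    triCoeff q e i j (algebraMap ℂ (H q) r) = if i = j then r else 0 := by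
  rw [triCoeff_apply hq, AlgHom.commutes, Matrix.algebraMap_matrix_apply]
  rfl

theorem triCoeff_lower {q : ℝ} (hq : 0 < q) (e : ℂ × ℂ) (x : H q) :
    triCoeff q e 1 0 x = 0 := by
  induction x using H.induction with
  | scalar r => simp [triCoeff_algebraMap hq]
  | of g => cases g <;> simp [triCoeff_of hq, triGen]
  | mul x y hx hy => simp [triCoeff_mul hq, hx, hy]
  | add x y hx hy => simp [hx, hy]

/-- The representation is upper triangular, so its diagonal entries are multiplicative independently
of the corner. The same K and K⁻¹ therefore occur in the rules for E and for F. -/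
theorem triCoeff_diag {q : ℝ} (hq : 0 < q) (e : ℂ × ℂ) (i : Fin 2) (x : H q) :
    triCoeff q e i i x = triCoeff q (0, 0) i i x := by
  induction x using H.induction with
  | scalar r => simp [triCoeff_algebraMap hq]
  | of g => cases g <;> fin_cases i <;> simp [triCoeff_of hq, triGen]
  | mul x y hx hy =>
    rw [triCoeff_mul hq, triCoeff_mul hq]
    fin_cases i <;> simp_all [triCoeff_lower hq]
  | add x y hx hy => simp [hx, hy]

theorem isMult_Kinv {q : ℝ} (hq : 0 < q) : IsMult (Kinv q) := fun x y => by
  simp [Kinv, triCoeff_mul hq, triCoeff_lower hq]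

theorem isMult_K {q : ℝ} (hq : 0 < q) : IsMult (K q) := fun x y => by
  simp [K, triCoeff_mul hq, triCoeff_lower hq]

theorem isMult_eps (q : ℝ) : IsMult (eps q) := fun x y =>
  map_mul (H.lift q epsGen (epsGen_unitary q)) x y

theorem isSkewDer_triCoeff {q : ℝ} (hq : 0 < q) (e : ℂ × ℂ) :
    IsSkewDer (Kinv q) (K q) (triCoeff q e 0 1) := fun x y => by
  rw [triCoeff_mul hq, triCoeff_diag hq e 0, triCoeff_diag hq e 1, add_comm]
  rfl

/-- The functional `K⁻²`. -/
def Kinv2 (q : ℝ) : Dual q := conv (Kinv q) (Kinv q)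

/-- The factor of the first argument in the Leibniz rule for `X_a`; both choices act as the
identity. -/
def rightFactor (q : ℝ) : Idx → Dual q
  | .z => eps q
  | _ => conv (K q) (Kinv q)

theorem isMult_Kinv2 {q : ℝ} (hq : 0 < q) : IsMult (Kinv2 q) :=
  (isMult_Kinv hq).conv (isMult_Kinv hq)

theorem isMult_rightFactor {q : ℝ} (hq : 0 < q) (a : Idx) : IsMult (rightFactor q a) := by
  cases a
  · exact (isMult_K hq).conv (isMult_Kinv hq)
  · exact isMult_eps q
  · exact (isMult_K hq).conv (isMult_Kinv hq)

theorem isSkewDer_tangent {q : ℝ} (hq : 0 < q) (a : Idx) :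
    IsSkewDer (Kinv2 q) (rightFactor q a) (tangent q a) := by
  cases a
  · exact ((isSkewDer_triCoeff hq _).conv (isMult_Kinv hq)).smul _
  -- A difference of two characters k - e is a skew derivation: k k' - e e' = (k - e) e' + k (k' -
  -- e').
  · refine IsSkewDer.smul (fun x y => ?_) _
    have h1 := (isMult_Kinv hq).conv (isMult_Kinv hq) x y
    have h2 := isMult_eps q x y
    simp only [LinearMap.sub_apply, h1, h2, rightFactor, Kinv2]
    ring
  · exact ((isSkewDer_triCoeff hq _).conv (isMult_Kinv hq)).smul _

theorem X_mul {q : ℝ} (hq : 0 < q) (a : Idx) (x y : H q) :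
    X q a (x * y) = X q a x * act (rightFactor q a) y + act (Kinv2 q) x * X q a y :=
  (isSkewDer_tangent hq a).act x y

/-! ### Values on generators -/

/-- Values of a convolution on generators. -/
theorem conv_of {q : ℝ} (f g : Dual q) (x : Gen) :
    conv f g (H.of q x) = match x with
      | .a => f (H.of q .a) * g (H.of q .a) - q * (f (H.of q .cStar) * g (H.of q .c))
      | .c => f (H.of q .c) * g (H.of q .a) + f (H.of q .aStar) * g (H.of q .c)
      | .aStar => f (H.of q .aStar) * g (H.of q .aStar) - q * (f (H.of q .c) * g (H.of q .cStar))
      | .cStar => f (H.of q .cStar) * g (H.of q .aStar) + f (H.of q .a) * g (H.of q .cStar) := by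
  rw [conv_apply_of_comul f g (comul_of q x)]
  cases x <;> simp [comulGen, -Complex.coe_smul]

/-- The action on generators. -/
theorem act_of {q : ℝ} (f : Dual q) (x : Gen) :
    act f (H.of q x) = match x with
      | .a => f (H.of q .a) • H.of q .a - (q * f (H.of q .c)) • H.of q .cStar
      | .c => f (H.of q .a) • H.of q .c + f (H.of q .c) • H.of q .aStar
      | .aStar => f (H.of q .aStar) • H.of q .aStar - (q * f (H.of q .cStar)) • H.of q .c
      | .cStar => f (H.of q .aStar) • H.of q .cStar + f (H.of q .cStar) • H.of q .a := by
  rw [act_apply_of_comul f (comul_of q x)]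
  cases x <;> simp [comulGen, -Complex.coe_smul, smul_smul]

theorem sqrt_ne_zero {q : ℝ} (hq : 0 < q) : (Real.sqrt q : ℂ) ≠ 0 := by
  exact_mod_cast (Real.sqrt_pos.2 hq).ne'

theorem sqrt_mul_sqrt {q : ℝ} (hq : 0 < q) : (Real.sqrt q : ℂ) * Real.sqrt q = q := by
  exact_mod_cast Real.mul_self_sqrt hq.le

theorem Kinv2_of {q : ℝ} (hq : 0 < q) (x : Gen) :
    Kinv2 q (H.of q x) = match x with
      | .a => (q : ℂ) | .aStar => (q : ℂ)⁻¹ | .c => 0 | .cStar => 0 := by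
  have h := sqrt_mul_sqrt hq
  have h0 := sqrt_ne_zero hq
  cases x <;> simp [Kinv2, conv_of, Kinv, triCoeff_of hq, triGen, h, ← mul_inv]

theorem rightFactor_of {q : ℝ} (hq : 0 < q) (a : Idx) (x : Gen) :
    rightFactor q a (H.of q x) = epsGen x := by
  have h0 := sqrt_ne_zero hq
  have h1 : eps q (H.of q x) = epsGen x := H.lift_of _ _ _ _
  cases a <;> cases x <;>
    simp [rightFactor, conv_of, K, Kinv, triCoeff_of hq, triGen, epsGen, h0] <;> exact h1

/-- For X_z the differences q - 1 at `a` and q⁻¹ - 1 at `a*` are divisible by 1 - q, so the pole at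
q = 1 disappears on generators. -/
theorem tangent_of {q : ℝ} (hq : 0 < q) (hq1 : q ≠ 1) (a : Idx) (x : Gen) :
    tangent q a (H.of q x) = match a, x with
      | .minus, .c => -(Complex.I / (Real.sqrt 2 : ℂ))
      | .plus, .cStar => Complex.I / (Real.sqrt 2 : ℂ) * (q : ℂ)⁻¹
      | .z, .a => -(Complex.I / 2)
      | .z, .aStar => Complex.I / 2 * (q : ℂ)⁻¹
      | _, _ => 0 := by
  have h := sqrt_mul_sqrt hq
  have h0 := sqrt_ne_zero hq
  have h1 : ∀ x, eps q (H.of q x) = epsGen x := fun x => H.lift_of _ _ _ _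
  have h2 : (q : ℂ) ≠ 0 := by exact_mod_cast hq.ne'
  have h3 : (1 : ℂ) - q ≠ 0 := sub_ne_zero.2 (by exact_mod_cast hq1.symm)
  cases a <;> cases x <;>
    simp [tangent, h1, conv_of, E, F, Kinv, triCoeff_of hq, triGen, epsGen, h0]
  · rw [h]
    field_simp
    ring
  · rw [← mul_inv, h]
    field_simp
  · field_simp

theorem X_of {q : ℝ} (hq : 0 < q) (hq1 : q ≠ 1) (a : Idx) (x : Gen) :
    X q a (H.of q x) = match a, x with
      | .minus, .a => ((q : ℂ) * (Complex.I / (Real.sqrt 2 : ℂ))) • H.of q .cStar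
      | .minus, .c => (-(Complex.I / (Real.sqrt 2 : ℂ))) • H.of q .aStar
      | .plus, .aStar => (-(Complex.I / (Real.sqrt 2 : ℂ))) • H.of q .c
      | .plus, .cStar => (Complex.I / (Real.sqrt 2 : ℂ) * (q : ℂ)⁻¹) • H.of q .a
      | .z, .a => (-(Complex.I / 2)) • H.of q .a
      | .z, .c => (-(Complex.I / 2)) • H.of q .c
      | .z, .aStar => (Complex.I / 2 * (q : ℂ)⁻¹) • H.of q .aStar
      | .z, .cStar => (Complex.I / 2 * (q : ℂ)⁻¹) • H.of q .cStar
      | _, _ => 0 := by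
  have h2 : (q : ℂ) ≠ 0 := by exact_mod_cast hq.ne'
  have h3 : (q : ℂ) * (Complex.I / (Real.sqrt 2 : ℂ) * (q : ℂ)⁻¹) =
      Complex.I / (Real.sqrt 2 : ℂ) := by
    rw [mul_left_comm, mul_inv_cancel₀ h2, mul_one]
  cases a <;> cases x <;> simp only [X, act_of, tangent_of hq hq1, h3] <;> module

/-! ### The commutation relations and monomials -/

/-- The commutation relations of the generators, written so that `a`, `a*` move to the left. -/
structure Relations {B : Type} [Ring B] [Algebra ℂ B] (q : ℝ) (x : Gen → B) : Prop where
  c_a : x .c * x .a = (q : ℂ)⁻¹ • (x .a * x .c)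
  c_aStar : x .c * x .aStar = (q : ℂ) • (x .aStar * x .c)
  cStar_a : x .cStar * x .a = (q : ℂ)⁻¹ • (x .a * x .cStar)
  cStar_aStar : x .cStar * x .aStar = (q : ℂ) • (x .aStar * x .cStar)
  cStar_c : x .cStar * x .c = x .c * x .cStar
  a_aStar : x .a * x .aStar = 1 - (q : ℂ) ^ 2 • (x .c * x .cStar)
  aStar_a : x .aStar * x .a = 1 - x .c * x .cStar

theorem Unitary.relations {B : Type} [Ring B] [Algebra ℂ B] {q : ℝ} (hq : 0 < q) {x : Gen → B}
    (hx : Unitary q x) : Relations q x := by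
  obtain ⟨h1, h2⟩ := hx
  have hq0 : (q : ℂ) ≠ 0 := by exact_mod_cast hq.ne'
  have e1 := congrFun (congrFun h1 0) 0
  have e2 := congrFun (congrFun h1 0) 1
  have e3 := congrFun (congrFun h1 1) 0
  have e4 := congrFun (congrFun h1 1) 1
  have e5 := congrFun (congrFun h2 0) 0
  have e6 := congrFun (congrFun h2 0) 1
  have e7 := congrFun (congrFun h2 1) 0
  have e8 := congrFun (congrFun h2 1) 1
  simp [-Complex.coe_smul, fundamental, fundamentalAdj, Matrix.mul_apply, Fin.sum_univ_two,
    smul_smul] at e1 e2 e3 e4 e5 e6 e7 e8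
  -- Both `e4` and `e5` write 1 as `a* a` plus a product of `c` and `c*`, in the two orders.
  have hc : x .cStar * x .c = x .c * x .cStar :=
    add_left_cancel (e5.trans (e4.symm.trans (add_comm _ _)))
  rw [← sub_eq_add_neg, sub_eq_zero] at e2 e3
  rw [neg_add_eq_zero] at e6 e7
  refine ⟨?_, e3, ?_, e6.symm, hc, ?_, ?_⟩
  · rw [← e7, smul_smul, inv_mul_cancel₀ hq0, one_smul]
  · rw [e2, smul_smul, inv_mul_cancel₀ hq0, one_smul]
  · rw [pow_two]
    exact eq_sub_of_add_eq' e8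
  · exact eq_sub_of_add_eq' e4

/-- With the functions on SU(2) treated as the case q = 1, each monomial formula below serves both
sides of the limit. The only input besides commutativity is that the first column of the matrix has
norm 1. -/
theorem relations_coord : Relations 1 coord := by
  have key : coord .aStar * coord .a = 1 - coord .c * coord .cStar := by
    ext p
    have h := congrFun (congrFun (Matrix.mem_unitaryGroup_iff'.1
      (Matrix.mem_specialUnitaryGroup_iff.1 p.2).1) 0) 0
    simp only [Matrix.mul_apply, Fin.sum_univ_two, Matrix.star_apply, Matrix.one_apply_eq] at h
    simp only [Pi.mul_apply, Pi.sub_apply, Pi.one_apply, coord, starRingEnd_apply]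
    linear_combination h
  refine ⟨?_, ?_, ?_, ?_, mul_comm _ _, ?_, key⟩
  · rw [mul_comm]; simp
  · rw [mul_comm]; simp
  · rw [mul_comm]; simp
  · rw [mul_comm]; simp
  · rw [mul_comm, key]; simp

theorem monomial_natCast {B : Type} [Monoid B] (x : Gen → B) (n j k : ℕ) :
    monomial x ((n : ℤ), j, k) = x .a ^ n * x .c ^ j * x .cStar ^ k := by
  simp [monomial]

theorem monomial_neg_natCast {B : Type} [Monoid B] (x : Gen → B) (n j k : ℕ) :
    monomial x (-(n : ℤ), j, k) = x .aStar ^ n * x .c ^ j * x .cStar ^ k := by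
  rcases n with _ | n
  · simp [monomial]
  · rw [monomial, if_neg (by simp; omega)]
    simp

theorem mul_pow_of_skew {B : Type} [Ring B] [Algebra ℂ B] {y z : B} {r : ℂ}
    (h : y * z = r • (z * y)) (n : ℕ) : y * z ^ n = r ^ n • (z ^ n * y) := by
  induction n with
  | zero => simp
  | succ n ih =>
    rw [pow_succ, ← mul_assoc, ih, smul_mul_assoc, mul_assoc, h, mul_smul_comm, smul_smul,
      mul_assoc, pow_succ]

theorem a_mul_monomial {B : Type} [Monoid B] (x : Gen → B) (n j k : ℕ) :
    x .a * monomial x ((n : ℤ), j, k) = monomial x (((n + 1 : ℕ) : ℤ), j, k) := by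
  rw [monomial_natCast, monomial_natCast, pow_succ']
  simp only [mul_assoc]

theorem aStar_mul_monomial {B : Type} [Monoid B] (x : Gen → B) (n j k : ℕ) :
    x .aStar * monomial x (-(n : ℤ), j, k) = monomial x (-((n + 1 : ℕ) : ℤ), j, k) := by
  rw [monomial_neg_natCast, monomial_neg_natCast, pow_succ']
  simp only [mul_assoc]

/-! ### Left multiplication of monomials by generators -/

section Relations

variable {B : Type} [Ring B] [Algebra ℂ B] {q : ℝ} {x : Gen → B}

theorem Relations.c_mul_monomial (h : Relations q x) (m : ℤ) (j k : ℕ) :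
    x .c * monomial x (m, j, k) = (q : ℂ) ^ (-m) • monomial x (m, j + 1, k) := by
  obtain ⟨n, rfl | rfl⟩ := m.eq_nat_or_neg
  · rw [monomial_natCast, monomial_natCast, ← mul_assoc, ← mul_assoc, mul_pow_of_skew h.c_a,
      smul_mul_assoc, smul_mul_assoc, mul_assoc _ (x .c), ← pow_succ', zpow_neg, zpow_natCast,
      inv_pow]
  · rw [monomial_neg_natCast, monomial_neg_natCast, ← mul_assoc, ← mul_assoc,
      mul_pow_of_skew h.c_aStar, smul_mul_assoc, smul_mul_assoc, mul_assoc _ (x .c), ← pow_succ',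
      neg_neg, zpow_natCast]

theorem Relations.cStar_mul_monomial (h : Relations q x) (m : ℤ) (j k : ℕ) :
    x .cStar * monomial x (m, j, k) = (q : ℂ) ^ (-m) • monomial x (m, j, k + 1) := by
  have hc : Commute (x .cStar) (x .c ^ j) := Commute.pow_right h.cStar_c j
  obtain ⟨n, rfl | rfl⟩ := m.eq_nat_or_neg
  · rw [monomial_natCast, monomial_natCast, ← mul_assoc, ← mul_assoc, mul_pow_of_skew h.cStar_a,
      smul_mul_assoc, smul_mul_assoc, mul_assoc _ (x .cStar), hc.eq, ← mul_assoc,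
      mul_assoc _ (x .cStar), ← pow_succ', zpow_neg, zpow_natCast, inv_pow]
  · rw [monomial_neg_natCast, monomial_neg_natCast, ← mul_assoc, ← mul_assoc,
      mul_pow_of_skew h.cStar_aStar, smul_mul_assoc, smul_mul_assoc, mul_assoc _ (x .cStar), hc.eq,
      ← mul_assoc, mul_assoc _ (x .cStar), ← pow_succ', neg_neg, zpow_natCast]

/-- Cancelling one factor `a*` leaves left multiplications by `c` and `c*`, which only rescale and
shift monomials. -/
theorem Relations.a_mul_monomial_neg (h : Relations q x) (n j k : ℕ) :
    x .a * monomial x (-((n + 1 : ℕ) : ℤ), j, k) = monomial x (-(n : ℤ), j, k) +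
      (-(q : ℂ) ^ 2) • (x .c * (x .cStar * monomial x (-(n : ℤ), j, k))) := by
  rw [← aStar_mul_monomial, ← mul_assoc, h.a_aStar, sub_mul, one_mul, smul_mul_assoc, mul_assoc,
    neg_smul, sub_eq_add_neg]

theorem Relations.aStar_mul_monomial_pos (h : Relations q x) (n j k : ℕ) :
    x .aStar * monomial x (((n + 1 : ℕ) : ℤ), j, k) = monomial x ((n : ℤ), j, k) +
      (-1 : ℂ) • (x .c * (x .cStar * monomial x ((n : ℤ), j, k))) := by
  rw [← a_mul_monomial, ← mul_assoc, h.aStar_a, sub_mul, one_mul, mul_assoc, neg_smul, one_smul,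
    sub_eq_add_neg]

end Relations

/-! ### Families with a classical limit -/

/-- The family `Z q` in `A(SU_q(2))` converges to the function `Z₁` on `SU(2)`: their coefficients
in the monomial bases are supported in a common finite set, and converge as `q → 1`. -/
def HasLimit (Z : (q : ℝ) → H q) (Z₁ : Matrix.specialUnitaryGroup (Fin 2) ℂ → ℂ) : Prop :=
  ∃ (s : Finset (ℤ × ℕ × ℕ)) (w : ℝ → ℤ × ℕ × ℕ → ℂ) (w₁ : ℤ × ℕ × ℕ → ℂ),
    (∀ q ∈ Set.Ioo (0 : ℝ) 1, Z q = ∑ n ∈ s, w q n • monomial (H.of q) n) ∧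
    (∀ n ∈ s, Tendsto (fun q => w q n) (𝓝[<] 1) (𝓝 (w₁ n))) ∧
    Z₁ = ∑ n ∈ s, w₁ n • monomial coord n

namespace HasLimit

variable {Z Z' : (q : ℝ) → H q} {Z₁ Z₁' : Matrix.specialUnitaryGroup (Fin 2) ℂ → ℂ}

theorem congr (h : HasLimit Z Z₁) (h' : ∀ q ∈ Set.Ioo (0 : ℝ) 1, Z' q = Z q) (h₁ : Z₁' = Z₁) :
    HasLimit Z' Z₁' := by
  obtain ⟨s, w, w₁, h1, h2, h3⟩ := h
  exact ⟨s, w, w₁, fun q hq => (h' q hq).trans (h1 q hq), h2, h₁.trans h3⟩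

theorem of_monomial (n : ℤ × ℕ × ℕ) :
    HasLimit (fun q => monomial (H.of q) n) (monomial coord n) :=
  ⟨{n}, fun _ _ => 1, fun _ => 1, by simp, fun _ _ => tendsto_const_nhds, by simp⟩

theorem zero : HasLimit (fun _ => 0) 0 :=
  ⟨∅, fun _ _ => 1, fun _ => 1, by simp, by simp, by simp⟩

theorem add (h : HasLimit Z Z₁) (h' : HasLimit Z' Z₁') :
    HasLimit (fun q => Z q + Z' q) (Z₁ + Z₁') := by
  classical
  obtain ⟨s, w, w₁, h1, h2, h3⟩ := h
  obtain ⟨s', w', w₁', h1', h2', h3'⟩ := h'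
  -- Coefficients outside their own support set are unconstrained, so they are cut off to zero
  -- before being added on the union.
  refine ⟨s ∪ s', fun q n => (if n ∈ s then w q n else 0) + (if n ∈ s' then w' q n else 0),
    fun n => (if n ∈ s then w₁ n else 0) + (if n ∈ s' then w₁' n else 0), ?_, ?_, ?_⟩
  · intro q hq
    simp only [h1 q hq, h1' q hq, add_smul, Finset.sum_add_distrib, ite_smul, zero_smul,
      Finset.sum_ite_mem, Finset.union_inter_cancel_left, Finset.union_inter_cancel_right]
  · intro n _
    refine Tendsto.add ?_ ?_
    · split_ifs with hn
      · exact h2 n hn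
      · exact tendsto_const_nhds
    · split_ifs with hn
      · exact h2' n hn
      · exact tendsto_const_nhds
  · simp only [h3, h3', add_smul, Finset.sum_add_distrib, ite_smul, zero_smul,
      Finset.sum_ite_mem, Finset.union_inter_cancel_left, Finset.union_inter_cancel_right]

theorem smul {r : ℝ → ℂ} {r₁ : ℂ} (hr : Tendsto r (𝓝[<] 1) (𝓝 r₁)) (h : HasLimit Z Z₁) :
    HasLimit (fun q => r q • Z q) (r₁ • Z₁) := by
  obtain ⟨s, w, w₁, h1, h2, h3⟩ := h
  refine ⟨s, fun q n => r q * w q n, fun n => r₁ * w₁ n, ?_, fun n hn => hr.mul (h2 n hn), ?_⟩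
  · intro q hq
    simp only [h1 q hq, Finset.smul_sum, mul_smul]
  · simp only [h3, Finset.smul_sum, mul_smul]

theorem sum {ι : Type*} (s : Finset ι) {Y : ι → (q : ℝ) → H q}
    {Y₁ : ι → Matrix.specialUnitaryGroup (Fin 2) ℂ → ℂ} (h : ∀ i ∈ s, HasLimit (Y i) (Y₁ i)) :
    HasLimit (fun q => ∑ i ∈ s, Y i q) (∑ i ∈ s, Y₁ i) := by
  classical
  induction s using Finset.induction_on with
  | empty => exact zero
  | insert i s hi ih =>
    exact ((h i (Finset.mem_insert_self i s)).add
      (ih fun j hj => h j (Finset.mem_insert_of_mem hj))).congr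
      (fun q _ => Finset.sum_insert hi) (Finset.sum_insert hi)

/-- It suffices to check left multiplication by a family on monomials. -/
theorem mul_of_monomial {Y : (q : ℝ) → H q} {Y₁ : Matrix.specialUnitaryGroup (Fin 2) ℂ → ℂ}
    (hY : ∀ n, HasLimit (fun q => Y q * monomial (H.of q) n) (Y₁ * monomial coord n))
    (h : HasLimit Z Z₁) : HasLimit (fun q => Y q * Z q) (Y₁ * Z₁) := by
  obtain ⟨s, w, w₁, h1, h2, h3⟩ := h
  refine (sum s fun n hn => (hY n).smul (h2 n hn)).congr (fun q hq => ?_) ?_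
  · simp only [h1 q hq, Finset.mul_sum, mul_smul_comm]
  · simp only [h3, Finset.mul_sum, mul_smul_comm]

/-- The limit is left unsimplified so that it matches the coefficients supplied by
`relations_coord`. -/
theorem tendsto_ofReal_zpow (m : ℤ) :
    Tendsto (fun q : ℝ => (q : ℂ) ^ m) (𝓝[<] 1) (𝓝 (((1 : ℝ) : ℂ) ^ m)) := by
  have h : ContinuousAt (fun q : ℝ => (q : ℂ) ^ m) 1 :=
    Complex.continuous_ofReal.continuousAt.zpow₀ m (Or.inl (by simp))
  exact h.mono_left nhdsWithin_le_nhds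

theorem c_mul (h : HasLimit Z Z₁) : HasLimit (fun q => H.of q .c * Z q) (coord .c * Z₁) := by
  refine mul_of_monomial (fun ⟨m, j, k⟩ => ?_) h
  exact ((of_monomial (m, j + 1, k)).smul (tendsto_ofReal_zpow (-m))).congr
    (fun q hq => ((H.unitary_of q).relations hq.1).c_mul_monomial m j k)
    (relations_coord.c_mul_monomial m j k)

theorem cStar_mul (h : HasLimit Z Z₁) :
    HasLimit (fun q => H.of q .cStar * Z q) (coord .cStar * Z₁) := by
  refine mul_of_monomial (fun ⟨m, j, k⟩ => ?_) h
  exact ((of_monomial (m, j, k + 1)).smul (tendsto_ofReal_zpow (-m))).congr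
    (fun q hq => ((H.unitary_of q).relations hq.1).cStar_mul_monomial m j k)
    (relations_coord.cStar_mul_monomial m j k)

theorem a_mul (h : HasLimit Z Z₁) : HasLimit (fun q => H.of q .a * Z q) (coord .a * Z₁) := by
  refine mul_of_monomial (fun ⟨m, j, k⟩ => ?_) h
  obtain ⟨n, rfl | rfl⟩ := m.eq_nat_or_neg
  · exact (of_monomial _).congr (fun q _ => a_mul_monomial _ n j k) (a_mul_monomial _ n j k)
  · rcases n with _ | n
    -- Since -0 = 0, this monomial also belongs to the nonnegative family and needs no reduction.
    · exact (of_monomial _).congr (fun q _ => a_mul_monomial _ 0 j k) (a_mul_monomial _ 0 j k)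
    · have hr : Tendsto (fun q : ℝ => -(q : ℂ) ^ 2) (𝓝[<] 1) (𝓝 (-((1 : ℝ) : ℂ) ^ 2)) :=
        (tendsto_ofReal_zpow 2).neg
      exact ((of_monomial _).add ((of_monomial _).cStar_mul.c_mul.smul hr)).congr
        (fun q hq => ((H.unitary_of q).relations hq.1).a_mul_monomial_neg n j k)
        (relations_coord.a_mul_monomial_neg n j k)

theorem aStar_mul (h : HasLimit Z Z₁) :
    HasLimit (fun q => H.of q .aStar * Z q) (coord .aStar * Z₁) := by
  refine mul_of_monomial (fun ⟨m, j, k⟩ => ?_) h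
  obtain ⟨n, rfl | rfl⟩ := m.eq_nat_or_neg
  · rcases n with _ | n
    · exact (of_monomial _).congr (fun q _ => aStar_mul_monomial _ 0 j k)
        (aStar_mul_monomial _ 0 j k)
    · exact ((of_monomial _).add ((of_monomial _).cStar_mul.c_mul.smul
        (tendsto_const_nhds (x := (-1 : ℂ))))).congr
        (fun q hq => ((H.unitary_of q).relations hq.1).aStar_mul_monomial_pos n j k)
        (relations_coord.aStar_mul_monomial_pos n j k)
  · exact (of_monomial _).congr (fun q _ => aStar_mul_monomial _ n j k)
      (aStar_mul_monomial _ n j k)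

theorem gen_mul (x : Gen) (h : HasLimit Z Z₁) :
    HasLimit (fun q => H.of q x * Z q) (coord x * Z₁) := by
  cases x
  · exact h.a_mul
  · exact h.c_mul
  · exact h.aStar_mul
  · exact h.cStar_mul

theorem gen_pow_mul (x : Gen) (n : ℕ) (h : HasLimit Z Z₁) :
    HasLimit (fun q => H.of q x ^ n * Z q) (coord x ^ n * Z₁) := by
  induction n with
  | zero => simpa using h
  | succ n ih => simpa only [pow_succ', mul_assoc] using ih.gen_mul x

/-- A monomial on the left acts as successive left multiplications by generators, each of which
preserves limits; linearity handles the general left factor. -/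
theorem mul (h : HasLimit Z Z₁) (h' : HasLimit Z' Z₁') :
    HasLimit (fun q => Z q * Z' q) (Z₁ * Z₁') := by
  have key : ∀ n, HasLimit (fun q => monomial (H.of q) n * Z' q) (monomial coord n * Z₁') := by
    rintro ⟨m, j, k⟩
    obtain ⟨n, rfl | rfl⟩ := m.eq_nat_or_neg
    · simpa only [monomial_natCast, mul_assoc] using
        ((h'.gen_pow_mul .cStar k).gen_pow_mul .c j).gen_pow_mul .a n
    · simpa only [monomial_neg_natCast, mul_assoc] using
        ((h'.gen_pow_mul .cStar k).gen_pow_mul .c j).gen_pow_mul .aStar n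
  obtain ⟨s, w, w₁, h1, h2, h3⟩ := h
  refine (sum s fun n hn => (key n).smul (h2 n hn)).congr (fun q hq => ?_) ?_
  · simp only [h1 q hq, Finset.sum_mul, smul_mul_assoc]
  · simp only [h3, Finset.sum_mul, smul_mul_assoc]

theorem one : HasLimit (fun _ => 1) 1 :=
  (of_monomial (0, 0, 0)).congr (fun q _ => by simp [monomial]) (by simp [monomial])

theorem of_gen (x : Gen) : HasLimit (fun q => H.of q x) (coord x) := by
  simpa using one.gen_mul x

end HasLimit

/-! ### The classical limit of the operators -/

theorem L_mul (a : Idx) (P Q : Pol) : L a (P * Q) = L a P * Q + P * L a Q := by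
  cases a <;> simp only [L, LinearMap.smul_apply, LinearMap.sub_apply, LinearMap.add_apply,
    Derivation.coeFn_coe, Derivation.leibniz, smul_eq_mul,
    MvPolynomial.smul_eq_C_mul] <;> ring

theorem L_X (a : Idx) (x : Gen) :
    L a (MvPolynomial.X x) = match a, x with
      | .minus, .a => (Complex.I / (Real.sqrt 2 : ℂ)) • MvPolynomial.X .cStar
      | .minus, .c => (-(Complex.I / (Real.sqrt 2 : ℂ))) • MvPolynomial.X .aStar
      | .plus, .aStar => (-(Complex.I / (Real.sqrt 2 : ℂ))) • MvPolynomial.X .c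
      | .plus, .cStar => (Complex.I / (Real.sqrt 2 : ℂ)) • MvPolynomial.X .a
      | .z, .a => (-(Complex.I / 2)) • MvPolynomial.X .a
      | .z, .c => (-(Complex.I / 2)) • MvPolynomial.X .c
      | .z, .aStar => (Complex.I / 2) • MvPolynomial.X .aStar
      | .z, .cStar => (Complex.I / 2) • MvPolynomial.X .cStar
      | _, _ => 0 := by
  cases a <;> cases x <;> simp only [L, LinearMap.smul_apply, LinearMap.sub_apply,
    LinearMap.add_apply, Derivation.coeFn_coe, Lx, Ly, Lz, MvPolynomial.mkDerivation_X] <;> module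

theorem L_one (a : Idx) : L a 1 = 0 := by
  cases a <;> simp [L]

/-- The family `p q` converges to the polynomial function `P`, as do its images under the
group-like elements in the Leibniz rules, and `X_a ▷ p q` converges to `L_a P`. -/
structure HasSmoothLimit (p : (q : ℝ) → H q) (P : Pol) : Prop where
  base : HasLimit p (toFunction P)
  left : HasLimit (fun q => act (Kinv2 q) (p q)) (toFunction P)
  right : ∀ a, HasLimit (fun q => act (rightFactor q a) (p q)) (toFunction P)
  deriv : ∀ a, HasLimit (fun q => X q a (p q)) (toFunction (L a P))

namespace HasSmoothLimit

variable {p p' : (q : ℝ) → H q} {P P' : Pol}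

/-- Differentiating a product by `X_mul` requires the limits of the images under `Kinv2` and
`rightFactor`. As these functionals are multiplicative, all four properties pass to products
together. -/
theorem mul (h : HasSmoothLimit p P) (h' : HasSmoothLimit p' P') :
    HasSmoothLimit (fun q => p q * p' q) (P * P') where
  base := (h.base.mul h'.base).congr (fun _ _ => rfl) (map_mul _ _ _)
  left := (h.left.mul h'.left).congr (fun _ hq => (isMult_Kinv2 hq.1).act _ _) (map_mul _ _ _)
  right a := ((h.right a).mul (h'.right a)).congr
    (fun _ hq => (isMult_rightFactor hq.1 a).act _ _) (map_mul _ _ _)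
  deriv a := (((h.deriv a).mul (h'.right a)).add (h.left.mul (h'.deriv a))).congr
    (fun _ hq => X_mul hq.1 a _ _) (by rw [L_mul, map_add, map_mul, map_mul])

theorem one : HasSmoothLimit (fun _ => 1) 1 where
  base := HasLimit.one.congr (fun _ _ => rfl) (map_one _)
  left := HasLimit.one.congr
    (fun q hq => by simp [act_one, Kinv2, conv_one, Kinv, triCoeff_apply hq.1]) (map_one _)
  right a := HasLimit.one.congr
    (fun q hq => by
      cases a <;> simp [act_one, rightFactor, conv_one, K, Kinv, eps, triCoeff_apply hq.1])
    (map_one _)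
  deriv a := HasLimit.zero.congr (fun q hq => X_one hq.1 a) (by rw [L_one, map_zero])

theorem of_gen (x : Gen) : HasSmoothLimit (fun q => H.of q x) (MvPolynomial.X x) := by
  have hX : ∀ x, toFunction (MvPolynomial.X x) = coord x := fun x => MvPolynomial.aeval_X _ _
  have hsmul : ∀ {r : ℝ → ℂ} {r₁ : ℂ} (_ : Tendsto r (𝓝[<] 1) (𝓝 r₁)) (y : Gen),
      HasLimit (fun q => r q • H.of q y) (r₁ • coord y) := fun hr y => (HasLimit.of_gen y).smul hr
  have t1 : Tendsto (fun q : ℝ => (q : ℂ)) (𝓝[<] 1) (𝓝 1) := by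
    simpa using HasLimit.tendsto_ofReal_zpow 1
  have t2 : Tendsto (fun q : ℝ => (q : ℂ)⁻¹) (𝓝[<] 1) (𝓝 1) := by
    simpa using HasLimit.tendsto_ofReal_zpow (-1)
  have t3 : ∀ r : ℂ, Tendsto (fun _ : ℝ => r) (𝓝[<] 1) (𝓝 r) := fun r => tendsto_const_nhds
  refine ⟨?_, ?_, ?_, ?_⟩
  · rw [hX]
    exact HasLimit.of_gen x
  · cases x
    · exact (hsmul t1 .a).congr (fun q hq => by simp [act_of, Kinv2_of hq.1]) (by simp [hX])
    · exact (hsmul t1 .c).congr (fun q hq => by simp [act_of, Kinv2_of hq.1]) (by simp [hX])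
    · exact (hsmul t2 .aStar).congr (fun q hq => by simp [act_of, Kinv2_of hq.1]) (by simp [hX])
    · exact (hsmul t2 .cStar).congr (fun q hq => by simp [act_of, Kinv2_of hq.1]) (by simp [hX])
  · intro a
    refine (HasLimit.of_gen x).congr (fun q hq => ?_) (hX x)
    cases x <;> simp [act_of, rightFactor_of hq.1, epsGen]
  · intro a
    have tA : Tendsto (fun q : ℝ => (q : ℂ) * (Complex.I / (Real.sqrt 2 : ℂ))) (𝓝[<] 1)
        (𝓝 (Complex.I / (Real.sqrt 2 : ℂ))) := by
      simpa using t1.mul (t3 (Complex.I / (Real.sqrt 2 : ℂ)))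
    have t4 : ∀ r : ℂ, Tendsto (fun q : ℝ => r * (q : ℂ)⁻¹) (𝓝[<] 1) (𝓝 r) := fun r => by
      simpa using (t3 r).mul t2
    cases a <;> cases x
    · exact (hsmul tA .cStar).congr
        (fun q hq => X_of hq.1 hq.2.ne .minus .a) (by simp only [L_X, map_smul, hX])
    · exact (hsmul (t3 (-(Complex.I / (Real.sqrt 2 : ℂ)))) .aStar).congr
        (fun q hq => X_of hq.1 hq.2.ne .minus .c) (by simp only [L_X, map_smul, hX])
    · exact HasLimit.zero.congr
        (fun q hq => X_of hq.1 hq.2.ne .minus .aStar) (by simp only [L_X, map_zero])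
    · exact HasLimit.zero.congr
        (fun q hq => X_of hq.1 hq.2.ne .minus .cStar) (by simp only [L_X, map_zero])
    · exact (hsmul (t3 (-(Complex.I / 2))) .a).congr
        (fun q hq => X_of hq.1 hq.2.ne .z .a) (by simp only [L_X, map_smul, hX])
    · exact (hsmul (t3 (-(Complex.I / 2))) .c).congr
        (fun q hq => X_of hq.1 hq.2.ne .z .c) (by simp only [L_X, map_smul, hX])
    · exact (hsmul (t4 (Complex.I / 2)) .aStar).congr
        (fun q hq => X_of hq.1 hq.2.ne .z .aStar) (by simp only [L_X, map_smul, hX])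
    · exact (hsmul (t4 (Complex.I / 2)) .cStar).congr
        (fun q hq => X_of hq.1 hq.2.ne .z .cStar) (by simp only [L_X, map_smul, hX])
    · exact HasLimit.zero.congr
        (fun q hq => X_of hq.1 hq.2.ne .plus .a) (by simp only [L_X, map_zero])
    · exact HasLimit.zero.congr
        (fun q hq => X_of hq.1 hq.2.ne .plus .c) (by simp only [L_X, map_zero])
    · exact (hsmul (t3 (-(Complex.I / (Real.sqrt 2 : ℂ)))) .c).congr
        (fun q hq => X_of hq.1 hq.2.ne .plus .aStar) (by simp only [L_X, map_smul, hX])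
    · exact (hsmul (t4 (Complex.I / (Real.sqrt 2 : ℂ))) .a).congr
        (fun q hq => X_of hq.1 hq.2.ne .plus .cStar) (by simp only [L_X, map_smul, hX])

theorem pow (h : HasSmoothLimit p P) (n : ℕ) : HasSmoothLimit (fun q => p q ^ n) (P ^ n) := by
  induction n with
  | zero => simpa using one
  | succ n ih => simpa only [pow_succ] using ih.mul h

theorem of_monomial (m : ℤ × ℕ × ℕ) :
    HasSmoothLimit (fun q => monomial (H.of q) m) (monomial MvPolynomial.X m) := by
  obtain ⟨m, j, k⟩ := m
  obtain ⟨n, rfl | rfl⟩ := m.eq_nat_or_neg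
  · simpa only [monomial_natCast] using
      (((of_gen .a).pow n).mul ((of_gen .c).pow j)).mul ((of_gen .cStar).pow k)
  · simpa only [monomial_neg_natCast] using
      (((of_gen .aStar).pow n).mul ((of_gen .c).pow j)).mul ((of_gen .cStar).pow k)

end HasSmoothLimit

theorem toFunction_monomial (m : ℤ × ℕ × ℕ) :
    toFunction (monomial MvPolynomial.X m) = monomial coord m := by
  simp only [monomial, map_mul, map_pow, apply_ite toFunction]
  simp [toFunction]

theorem convergesToClassical_iff {P : (q : ℝ) → Module.End ℂ (H q)} {Q : Module.End ℂ Pol} :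
    ConvergesToClassical P Q ↔ ∀ m, HasLimit (fun q => P q (monomial (H.of q) m))
      (toFunction (Q (monomial MvPolynomial.X m))) := by
  simp only [ConvergesToClassical, HasLimit, toFunction_monomial]

namespace ConvergesToClassical

variable {P P' : (q : ℝ) → Module.End ℂ (H q)} {Q Q' : Module.End ℂ Pol}

theorem tangent (a : Idx) : ConvergesToClassical (fun q => X q a) (L a) :=
  convergesToClassical_iff.2 fun m => (HasSmoothLimit.of_monomial m).deriv a

theorem one : ConvergesToClassical (fun _ => 1) 1 :=
  convergesToClassical_iff.2 fun m => (HasSmoothLimit.of_monomial m).base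

theorem zero : ConvergesToClassical (fun _ => 0) 0 :=
  convergesToClassical_iff.2 fun _ => HasLimit.zero.congr (fun _ _ => rfl) (map_zero _)

theorem add (h : ConvergesToClassical P Q) (h' : ConvergesToClassical P' Q') :
    ConvergesToClassical (fun q => P q + P' q) (Q + Q') :=
  convergesToClassical_iff.2 fun m =>
    ((convergesToClassical_iff.1 h m).add (convergesToClassical_iff.1 h' m)).congr
      (fun _ _ => rfl) (map_add _ _ _)

theorem smul {r : ℝ → ℂ} {r₁ : ℂ} (h : ConvergesToClassical P Q)
    (hr : Tendsto r (𝓝[<] 1) (𝓝 r₁)) :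
    ConvergesToClassical (fun q => r q • P q) (r₁ • Q) :=
  convergesToClassical_iff.2 fun m =>
    ((convergesToClassical_iff.1 h m).smul hr).congr (fun _ _ => rfl)
      (map_smul toFunction _ _)

theorem neg (h : ConvergesToClassical P Q) : ConvergesToClassical (fun q => -P q) (-Q) :=
  convergesToClassical_iff.2 fun m =>
    ((convergesToClassical_iff.1 h m).smul (tendsto_const_nhds (x := (-1 : ℂ)))).congr
      (fun _ _ => (neg_one_smul ℂ _).symm) ((map_neg toFunction _).trans (neg_one_smul ℂ _).symm)

theorem sub (h : ConvergesToClassical P Q) (h' : ConvergesToClassical P' Q') :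
    ConvergesToClassical (fun q => P q - P' q) (Q - Q') := by
  simpa only [sub_eq_add_neg] using h.add h'.neg

theorem of_eq (h : ConvergesToClassical P Q) (e : Q = Q') : ConvergesToClassical P Q' := e ▸ h

end ConvergesToClassical

/-! ### Limits of the parameters and of the matrix -/

theorem tendsto_coefA : Tendsto coefA (𝓝[<] 1) (𝓝 1) := by
  have h : Continuous coefA := by
    unfold coefA lam2 lam3
    have : ∀ q : ℝ, 1 + q ^ 2 ≠ 0 := fun q => by positivity
    fun_prop (disch := intro; apply this)
  have e : coefA 1 = 1 := by norm_num [coefA, lam2, lam3]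
  have ht := h.tendsto 1
  rw [e] at ht
  exact ht.mono_left nhdsWithin_le_nhds

section Limit

variable {α β γ δ ξ : ℝ → ℝ}

theorem tendsto_xi
    (h : ∀ q ∈ Set.Ioo (0 : ℝ) 1, IsCartanKilling q (α q) (β q) (γ q) (δ q) (ξ q))
    (hα : Tendsto α (𝓝[<] 1) (𝓝 1)) : Tendsto ξ (𝓝[<] 1) (𝓝 (-1)) := by
  have h1 : Tendsto (fun q : ℝ => q⁻¹ * Real.sqrt (lam3 q / 6)) (𝓝[<] 1) (𝓝 1) := by
    have hc : ContinuousAt (fun q : ℝ => q⁻¹ * Real.sqrt (lam3 q / 6)) 1 := by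
      unfold lam3
      fun_prop (disch := norm_num)
    have e : (1 : ℝ)⁻¹ * Real.sqrt (lam3 1 / 6) = 1 := by norm_num [lam3]
    exact (e ▸ hc.tendsto).mono_left nhdsWithin_le_nhds
  have h2 : Tendsto (fun q => -(q⁻¹ * Real.sqrt (lam3 q / 6) / Real.sqrt (α q))) (𝓝[<] 1)
      (𝓝 (-1)) := by
    simpa using (h1.div (hα.sqrt) (by simp)).neg
  refine h2.congr' ?_
  -- The closed formula for ξ is available only on (0,1), which is a left neighbourhood of 1.
  filter_upwards [Ioo_mem_nhdsLT (zero_lt_one' ℝ)] with q hq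
  exact ((isCartanKilling_iff hq.1 _ _ _ _ _).1 (h q hq)).2.2.2.2.symm

theorem tendsto_beta
    (h : ∀ q ∈ Set.Ioo (0 : ℝ) 1, IsCartanKilling q (α q) (β q) (γ q) (δ q) (ξ q))
    (hα : Tendsto α (𝓝[<] 1) (𝓝 1)) : Tendsto β (𝓝[<] 1) (𝓝 1) := by
  refine hα.congr' ?_
  filter_upwards [Ioo_mem_nhdsLT (zero_lt_one' ℝ)] with q hq
  exact ((isCartanKilling_iff hq.1 _ _ _ _ _).1 (h q hq)).2.1.symm

theorem tendsto_gamma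
    (h : ∀ q ∈ Set.Ioo (0 : ℝ) 1, IsCartanKilling q (α q) (β q) (γ q) (δ q) (ξ q))
    (hα : Tendsto α (𝓝[<] 1) (𝓝 1)) : Tendsto γ (𝓝[<] 1) (𝓝 1) := by
  have h1 : Tendsto (fun q : ℝ => (2 * q / (1 + q)) ^ 2) (𝓝[<] 1) (𝓝 1) := by
    have hc : ContinuousAt (fun q : ℝ => (2 * q / (1 + q)) ^ 2) 1 := by
      fun_prop (disch := norm_num)
    have e : (2 * 1 / (1 + 1) : ℝ) ^ 2 = 1 := by norm_num
    exact (e ▸ hc.tendsto).mono_left nhdsWithin_le_nhds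
  have h2 : Tendsto (fun q => (2 * q / (1 + q)) ^ 2 * α q) (𝓝[<] 1) (𝓝 1) := by
    simpa using h1.mul hα
  refine h2.congr' ?_
  filter_upwards [Ioo_mem_nhdsLT (zero_lt_one' ℝ)] with q hq
  exact ((isCartanKilling_iff hq.1 _ _ _ _ _).1 (h q hq)).2.2.1.symm

/-- The scalar A/ξ tends to -1 and reverses the signs in the lower 3 × 3 block, while 1 - q → 0
removes X_z from its central entry. The other scalar factors have limit 1. -/
theorem diracMatrix_convergesToClassical
    (h : ∀ q ∈ Set.Ioo (0 : ℝ) 1, IsCartanKilling q (α q) (β q) (γ q) (δ q) (ξ q))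
    (hα : Tendsto α (𝓝[<] 1) (𝓝 1)) (i j : Fin 4) :
    ConvergesToClassical (fun q => diracMatrix q (α q) (β q) (γ q) (ξ q) i j)
      (classicalMatrix i j) := by
  have cast : ∀ {f : ℝ → ℝ} {r : ℝ}, Tendsto f (𝓝[<] 1) (𝓝 r) →
      Tendsto (fun q => (f q : ℂ)) (𝓝[<] 1) (𝓝 (r : ℂ)) :=
    fun hf => (Complex.continuous_ofReal.tendsto _).comp hf
  have rat : ∀ {f : ℂ → ℂ} {r : ℂ}, ContinuousAt f 1 → f 1 = r →
      Tendsto (fun q : ℝ => f (q : ℂ)) (𝓝[<] 1) (𝓝 r) := by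
    intro f r hf e
    have h1 : Tendsto (fun q : ℝ => (q : ℂ)) (𝓝[<] 1) (𝓝 1) := by
      simpa using HasLimit.tendsto_ofReal_zpow 1
    exact (e ▸ hf.tendsto).comp h1
  have tα := cast hα
  have tβ := cast (tendsto_beta h hα)
  have tγ := cast (tendsto_gamma h hα)
  have ts : Tendsto (fun q => (coefA q : ℂ) * (ξ q : ℂ)⁻¹) (𝓝[<] 1) (𝓝 (-1)) := by
    have := (cast tendsto_coefA).mul ((cast (tendsto_xi h hα)).inv₀ (by simp))
    simpa using this
  have hI : ConvergesToClassical (fun q => Complex.I • (1 : Module.End ℂ (H q)))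
    (Complex.I • (1 : Module.End ℂ Pol)) := ConvergesToClassical.one.smul tendsto_const_nhds
  have hX := ConvergesToClassical.tangent
  have r1 : Tendsto (fun q : ℝ => 2 * (q : ℂ) ^ 2 / (1 + (q : ℂ))) (𝓝[<] 1) (𝓝 1) :=
    rat (f := fun p => 2 * p ^ 2 / (1 + p)) (by fun_prop (disch := norm_num)) (by norm_num)
  have r2 : Tendsto (fun q : ℝ => 2 / (1 + (q : ℂ))) (𝓝[<] 1) (𝓝 1) :=
    rat (f := fun p => 2 / (1 + p)) (by fun_prop (disch := norm_num)) (by norm_num)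
  have r3 : Tendsto (fun q : ℝ => (1 + (q : ℂ)) / 2) (𝓝[<] 1) (𝓝 1) :=
    rat (f := fun p => (1 + p) / 2) (by fun_prop (disch := norm_num)) (by norm_num)
  have r4 : Tendsto (fun q : ℝ => (1 + (q : ℂ)) / (2 * (q : ℂ) ^ 2)) (𝓝[<] 1) (𝓝 1) :=
    rat (f := fun p => (1 + p) / (2 * p ^ 2)) (by fun_prop (disch := norm_num)) (by norm_num)
  have r5 : Tendsto (fun q : ℝ => 1 - (q : ℂ)) (𝓝[<] 1) (𝓝 0) :=
    rat (f := fun p => 1 - p) (by fun_prop) (by norm_num)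
  have r6 : Tendsto (fun q : ℝ => (q : ℂ) ^ 4) (𝓝[<] 1) (𝓝 1) :=
    rat (f := fun p => p ^ 4) (by fun_prop) (by norm_num)
  have r7 : Tendsto (fun q : ℝ => (q : ℂ) ^ 2) (𝓝[<] 1) (𝓝 1) :=
    rat (f := fun p => p ^ 2) (by fun_prop) (by norm_num)
  fin_cases i <;> fin_cases j
  · exact ConvergesToClassical.zero
  · exact ((hX .plus).smul (r6.mul tα)).of_eq (by simp [classicalMatrix])
  · exact ((hX .z).smul (r7.mul tγ)).of_eq (by simp [classicalMatrix])
  · exact ((hX .minus).smul tβ).of_eq (by simp [classicalMatrix])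
  · exact hX .minus
  · exact ((hI.sub ((hX .z).smul r1)).smul ts).of_eq (by simp [classicalMatrix]; module)
  · exact ((hX .minus).smul (ts.mul r2)).of_eq (by simp [classicalMatrix]; module)
  · exact ConvergesToClassical.zero
  · exact hX .z
  · exact ((hX .plus).smul (ts.mul r3)).of_eq (by simp [classicalMatrix]; module)
  · exact ((hI.add ((hX .z).smul r5)).smul ts).of_eq (by simp [classicalMatrix]; module)
  · exact ((hX .minus).smul (ts.mul r4)).neg.of_eq (by simp [classicalMatrix]; module)
  · exact hX .plus
  · exact ConvergesToClassical.zero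
  · exact ((hX .plus).smul (ts.mul r1)).neg.of_eq (by simp [classicalMatrix]; module)
  · exact ((hI.add ((hX .z).smul r2)).smul ts).of_eq (by simp [classicalMatrix]; module)

end Limit

end SUq2

end

theorem mainTheorem3 :
    (∀ q ∈ Set.Ioo (0 : ℝ) 1, ∀ α β γ δ ξ : ℝ,
      (SUq2.IsCartanKilling q α β γ δ ξ ↔
        0 < α ∧ β = α ∧ γ = (2 * q / (1 + q)) ^ 2 * α ∧
          δ = (1 + q) / (2 * q ^ 3) * Real.sqrt (SUq2.lam3 q / 6) / (α * Real.sqrt α) ∧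
          ξ = -(q⁻¹ * Real.sqrt (SUq2.lam3 q / 6) / Real.sqrt α)) ∧
      (SUq2.IsCartanKilling q α β γ δ ξ →
        ∀ (ε : ℕ → ℂ) (κ : ℂ), ε 1 = 1 → ε 3 = 1 → ε 2 = -1 →
          κ = -Complex.I * ((SUq2.coefA q : ℝ) : ℂ)⁻¹ →
          (∀ (t : SUq2.T1 q) (η : SUq2.G2 q),
            SUq2.star q α β γ δ (SUq2.star q α β γ δ (0, t, η, 0)) =
              ((SUq2.coefA q : ℝ) : ℂ) • ((0, t, η, 0) : SUq2.Form q)) ∧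
          LinearIndependent (SUq2.H q) (SUq2.spinorBasis q α β γ δ ε κ) ∧
          (∀ ψ ∈ SUq2.spinors q α β γ δ ε κ,
            SUq2.dirac q α β γ δ ε ψ ∈ SUq2.spinors q α β γ δ ε κ) ∧
          (∀ f : Fin 4 → SUq2.H q,
            SUq2.dirac q α β γ δ ε (∑ j, f j • SUq2.spinorBasis q α β γ δ ε κ j) =
              ∑ i, (∑ j, SUq2.diracMatrix q α β γ ξ i j (f j)) •
                SUq2.spinorBasis q α β γ δ ε κ i))) ∧
    (∀ α β γ δ ξ : ℝ → ℝ,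
      (∀ q ∈ Set.Ioo (0 : ℝ) 1, SUq2.IsCartanKilling q (α q) (β q) (γ q) (δ q) (ξ q)) →
      Tendsto α (𝓝[<] 1) (𝓝 1) →
        Tendsto SUq2.coefA (𝓝[<] 1) (𝓝 1) ∧ Tendsto ξ (𝓝[<] 1) (𝓝 (-1)) ∧
        ∀ i j : Fin 4,
          SUq2.ConvergesToClassical
            (fun q => SUq2.diracMatrix q (α q) (β q) (γ q) (ξ q) i j)
            (SUq2.classicalMatrix i j)) := by
  refine ⟨fun q hq α β γ δ ξ => ⟨SUq2.isCartanKilling_iff hq.1 α β γ δ ξ, ?_⟩, ?_⟩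
  · intro h ε κ hε1 hε3 hε2 hκ
    exact ⟨SUq2.star_star_one_two hq.1 h, SUq2.linearIndependent_spinorBasis α β γ δ ε κ hε3,
      fun ψ hψ => SUq2.dirac_mem_spinors hq.1 h ε κ hε1 hε3 hε2 hκ hψ,
      SUq2.dirac_spinor hq.1 h ε κ hε1 hε3 hε2 hκ⟩
  · intro α β γ δ ξ h hα
    exact ⟨SUq2.tendsto_coefA, SUq2.tendsto_xi h hα, SUq2.diracMatrix_convergesToClassical h hα⟩
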